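/- **Setting.** Let $(X,d)$ be a metric space with a Borel regular measure $\mu$ such that $0<\mu(B)<\infty$ for every ball $B=B(x,r)=\{y: d(x,y)<r\}$, $r>0$, and, for some $D>1$, $\mu(B(x,2r))\le D\,\mu(B(x,r))$ for all $x\in X$, $r>0$. A *curve* is a rectifiable continuous map $\gamma:[a,b]\to X$, and $\int_\gamma g\,ds$ is the integral of $g$ with respect to arc length. Assume that $X$ is $C_{\mathrm{QC}}$-quasiconvex for some $C_{\mathrm{QC}}\ge 1$: any $x,y\in X$ are joined by a curve of length at most $C_{\mathrm{QC}}\,d(x,y)$. For $\nu>0$ let $\Gamma^\nu_{x,y}$ be the set of curves from $x$ to $y$ of length at most $\nu\, d(x,y)$. A Borel function $g\ge 0$ is an *upper gradient* of $u:X\to\mathbb R$ if $|u(\gamma(a))-u(\gamma(b))|\le\int_\gamma g\,ds$ for all curves $\gamma:[a,b]\to X$. Let $\emptyset\ne\Omega\subsetneq X$ be open, $\Omega^c=X\setminus\Omega$. Let $\operatorname{Lip}_0(\Omega)$ be the set of Lipschitz functions $u:X\to\mathbb R$ with $u=0$ on $\Omega^c$. A *weight* for $\Omega$ is a Borel function $w:X\to[0,\infty]$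 with $w(B):=\int_B w\,d\mu<\infty$ for all balls $B$ and $w>0$ $\mu$-almost everywhere in $\Omega$. It is *semilocally doubling* for $\Omega$ if for every $\kappa>0$ there is $D(w,\kappa)\ge 1$ such that $$0<w(B(x,r))\le D(w,\kappa)\,w(B(x,r/2))<\infty\qquad\text{for all }x\in\Omega,\ 0<r\le\kappa\, d(x,\Omega^c).$$ For $1\le p<\infty$, $\kappa>0$, $R>0$, $x\in\Omega$ and Borel $f\ge0$ put $$\mathcal M_{p,w,\kappa}f(x)=\sup_{0<r<\kappa d(x,\Omega^c)}\Bigl(\frac1{w(B(x,r))}\int_{B(x,r)}f^p\,w\,d\mu\Bigr)^{1/p},$$ and let $\mathcal M^R_{p,w,\kappa}f(x)$ be the same supremum over $0<r<\min\{\kappa d(x,\Omega^c),R\}$. A weight $w$ is a *$p$-Poincaré weight* for $\Omega$ if there are constants $C_A>0$, $\nu>C_{\mathrm{QC}}$ and $\kappa>1$ such that, for every non-negative bounded lower semicontinuous $g$ on $X$ and all $x,y\in\Omega$ with $d(x,y)<d(x,\Omega^c)/(3\kappa)$, $$\inf_{\gamma\in\Gamma^\nu_{x,y}}\int_\gamma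 g\,ds\le C_A\,d(x,y)\Bigl(\mathcal M^{\kappa d(x,y)}_{p,w,\kappa}g(x)+\mathcal M^{\kappa d(x,y)}_{p,w,\kappa}g(y)\Bigr)$$ (for $x=y$ the right-hand side is $0$). A *pointwise $(p,w)$-Hardy inequality holds in $\Omega$* if there are constants $C_H>0$ and $\kappa>1$ such that, for every $u\in\operatorname{Lip}_0(\Omega)$, every bounded upper gradient $g$ of $u$ and every $x\in\Omega$, $$|u(x)|\le C_H\,d(x,\Omega^c)\,\mathcal M_{p,w,\kappa}g(x).$$ **Theorem.** Let $1\le p_0<p<\infty$, and let $w$ be a semilocally doubling $p_0$-Poincaré weight for $\Omega$. If a pointwise $(p,w)$-Hardy inequality holds in $\Omega$, then there exists $q\in(p_0,p)$ such that a pointwise $(q,w)$-Hardy inequality holds in $\Omega$. -/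

import Mathlib

open MeasureTheory Set
open scoped ENNReal NNReal

noncomputable section

namespace PointwiseHardy

/-! ### Curves and line integrals -/

/-- A curve in `X`: a rectifiable continuous map `[a, b] → X`
(only the values of `toFun` on `[a, b]` matter). -/
structure Curve (X : Type*) [MetricSpace X] where
  a : ℝ
  b : ℝ
  le : a ≤ b
  toFun : ℝ → X
  continuousOn : ContinuousOn toFun (Icc a b)
  rectifiable : BoundedVariationOn toFun (Icc a b)

variable {X : Type*} [MetricSpace X]

/-- The initial point `γ(a)`. -/
def Curve.source (γ : Curve X) : X := γ.toFun γ.a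

/-- The terminal point `γ(b)`. -/
def Curve.target (γ : Curve X) : X := γ.toFun γ.b

/-- The length of a curve: its total variation on `[a, b]`, which is finite by rectifiability. -/
def Curve.length (γ : Curve X) : ℝ := (eVariationOn γ.toFun (Icc γ.a γ.b)).toReal

/-- The line integral `∫_γ g ds`, computed in the arc length parametrization of `γ`,
which is defined on `[0, length γ]`. -/
def Curve.lineIntegral (γ : Curve X) (g : X → ℝ≥0∞) : ℝ≥0∞ :=
  ∫⁻ t in Icc 0 γ.length, g (naturalParameterization γ.toFun (Icc γ.a γ.b) γ.a t)

/-- `Γ(X)^ν_{x,y}`: the curves from `x` to `y` of length at most `ν d(x,y)`. -/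
def curvesBetween (ν : ℝ) (x y : X) : Set (Curve X) :=
  {γ | γ.source = x ∧ γ.target = y ∧ γ.length ≤ ν * dist x y}

variable (X) in
/-- `X` is `C`-quasiconvex: any two points are joined by a curve of length at most `C d(x,y)`. -/
def IsQuasiconvex (C : ℝ) : Prop :=
  ∀ x y : X, (curvesBetween C x y).Nonempty

/-- `Lip₀(Ω)`: the Lipschitz functions on the whole space that vanish outside `Ω`. -/
def LipZero (Ω : Set X) : Set (X → ℝ) :=
  {u | (∃ K : ℝ≥0, LipschitzWith K u) ∧ ∀ x ∈ Ωᶜ, u x = 0}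

variable [MeasurableSpace X]

/-- The Borel function `g ≥ 0` is an upper gradient of `u`. The ambient measurable space is
always the Borel one. -/
def IsUpperGradient (g : X → ℝ≥0) (u : X → ℝ) : Prop :=
  Measurable g ∧ ∀ γ : Curve X,
    ENNReal.ofReal |u γ.source - u γ.target| ≤ γ.lineIntegral (fun x => (g x : ℝ≥0∞))

/-! ### Doubling measures, weights and restricted maximal functions -/

/-- All balls have positive finite measure, and `μ(2B) ≤ D μ(B)` for all balls, for some `D > 1`. -/
def IsDoubling (μ : Measure X) : Prop :=
  (∀ (x : X) (r : ℝ), 0 < r → 0 < μ (Metric.ball x r) ∧ μ (Metric.ball x r) < ∞) ∧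
    ∃ D : ℝ≥0, 1 < D ∧ ∀ (x : X) (r : ℝ), 0 < r →
      μ (Metric.ball x (2 * r)) ≤ D * μ (Metric.ball x r)

/-- `w(E) = ∫_E w dμ`. -/
def wMeas (μ : Measure X) (w : X → ℝ≥0∞) (E : Set X) : ℝ≥0∞ := ∫⁻ y in E, w y ∂μ

/-- `w` is a weight for `Ω`. -/
structure IsWeight (μ : Measure X) (Ω : Set X) (w : X → ℝ≥0∞) : Prop where
  measurable : Measurable w
  finite_ball : ∀ (x : X) (r : ℝ), 0 < r → wMeas μ w (Metric.ball x r) < ∞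
  pos : ∀ᵐ x ∂μ, x ∈ Ω → 0 < w x

/-- `w` is a semilocally doubling weight for `Ω`. -/
structure IsSemilocallyDoubling (μ : Measure X) (Ω : Set X) (w : X → ℝ≥0∞) : Prop where
  weight : IsWeight μ Ω w
  doubling : ∀ κ : ℝ, 0 < κ → ∃ D : ℝ≥0, 1 ≤ D ∧
    ∀ x ∈ Ω, ∀ r : ℝ, 0 < r → r ≤ κ * Metric.infDist x Ωᶜ →
      0 < wMeas μ w (Metric.ball x r) ∧
      wMeas μ w (Metric.ball x r) ≤ D * wMeas μ w (Metric.ball x (r / 2)) ∧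
      D * wMeas μ w (Metric.ball x (r / 2)) < ∞

/-- `(w(B(x,r))⁻¹ ∫_{B(x,r)} f^p w dμ)^{1/p}` for nonnegative `f`. -/
def wMean (μ : Measure X) (w : X → ℝ≥0∞) (p : ℝ) (f : X → ℝ≥0∞) (x : X) (r : ℝ) : ℝ≥0∞ :=
  ((∫⁻ y in Metric.ball x r, f y ^ p * w y ∂μ) / wMeas μ w (Metric.ball x r)) ^ (1 / p)

/-- The restricted maximal function `M_{p,w,κ} f` at `x ∈ Ω`, for nonnegative `f`. -/
def maximal (μ : Measure X) (Ω : Set X) (w : X → ℝ≥0∞) (p κ : ℝ) (f : X → ℝ≥0∞) (x : X) :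
    ℝ≥0∞ :=
  ⨆ (r : ℝ) (_ : 0 < r ∧ r < κ * Metric.infDist x Ωᶜ), wMean μ w p f x r

/-- The restricted maximal function `M^R_{p,w,κ} f` at `x ∈ Ω`, for nonnegative `f`. -/
def maximalR (μ : Measure X) (Ω : Set X) (w : X → ℝ≥0∞) (p κ R : ℝ) (f : X → ℝ≥0∞) (x : X) :
    ℝ≥0∞ :=
  ⨆ (r : ℝ) (_ : 0 < r ∧ r < min (κ * Metric.infDist x Ωᶜ) R), wMean μ w p f x r

/-! ### Poincaré weights and pointwise Hardy inequalities -/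

/-- `w` is a `p`-Poincaré weight for `Ω`; here `CQC` is the quasiconvexity constant of `X`. -/
def IsPoincareWeight (CQC : ℝ) (μ : Measure X) (Ω : Set X) (w : X → ℝ≥0∞) (p : ℝ) : Prop :=
  IsWeight μ Ω w ∧ ∃ (CA : ℝ≥0) (ν κ : ℝ), 0 < CA ∧ CQC < ν ∧ 1 < κ ∧
    ∀ g : X → ℝ≥0, LowerSemicontinuous g → (∃ M : ℝ≥0, ∀ z, g z ≤ M) →
      ∀ x ∈ Ω, ∀ y ∈ Ω, dist x y < Metric.infDist x Ωᶜ / (3 * κ) →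
        ⨅ γ ∈ curvesBetween ν x y, γ.lineIntegral (fun z => (g z : ℝ≥0∞)) ≤
          CA * ENNReal.ofReal (dist x y) *
            (maximalR μ Ω w p κ (κ * dist x y) (fun z => (g z : ℝ≥0∞)) x +
              maximalR μ Ω w p κ (κ * dist x y) (fun z => (g z : ℝ≥0∞)) y)

/-- A pointwise `(p,w)`-Hardy inequality holds in `Ω`. -/
def PointwiseHardyInequality (μ : Measure X) (Ω : Set X) (w : X → ℝ≥0∞) (p : ℝ) : Prop :=
  ∃ (CH : ℝ≥0) (κ : ℝ), 0 < CH ∧ 1 < κ ∧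
    ∀ u ∈ LipZero Ω, ∀ g : X → ℝ≥0, IsUpperGradient g u → (∃ M : ℝ≥0, ∀ z, g z ≤ M) →
      ∀ x ∈ Ω, ENNReal.ofReal |u x| ≤
        CH * ENNReal.ofReal (Metric.infDist x Ωᶜ) *
          maximal μ Ω w p κ (fun z => (g z : ℝ≥0∞)) x

end PointwiseHardy

end

/-!
The theorem is a self-improvement result, and the argument works with functions rather than with
curves. Put `ρ = w dμ`, `d(y) = d(y, Ωᶜ)`, and let `M` be the maximal function of exponent `q` for
an upper gradient `g` of a nonnegative `u ∈ Lip₀(Ω)`. Suppose that `u ≤ S d M` holds in `Ω` with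
some constant `S`. Fix `x ∈ Ω`, put `τ = M(x)`, and consider the levels `sᵢ = t ^ (i + 1) τ`,
`i < k`, for a fixed large `t`. On the set where `M ≤ sᵢ`, the truncation `min u (u x)` is locally
`C sᵢ`-Lipschitz by the Poincaré condition, and it decays at the boundary like `4 S sᵢ d`.
So it has a `C (1 + S) sᵢ`-Lipschitz extension `fᵢ` from that set and `Ωᶜ`, which coincides with
`u` at `x` (`exists_truncated_extension`), and which has the upper gradient
`C sᵢ + C (1 + S) sᵢ 1_{Eᵢ}`, where `Eᵢ` is the superlevel set
(`isUpperGradient_of_locally_lipschitz`). In particular `g` itself no longer occurs.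

The `p`-Hardy inequality is then applied to the average of `f₀, …, fₖ₋₁`. The weak type estimate
`ρ(B ∩ Eᵢ) ≤ C t ^ (-(i + 1) q) ρ(B)` for balls `B` centred at `x` (`measure_lt_maxMean_le`), and
the fact that `∑ t ^ (i + 1) 1_{Eᵢ}` is comparable with its largest term, show that the averaged
upper gradient has a maximal function of size `C t ^ k τ + C (1 + S) k ^ (1 / p - 1) τ` at `x`, as
soon as `t ^ (k (p - q)) ≤ 2`. Hence `u ≤ (C' + ε S) d M` with `ε = C k ^ (1 / p - 1)`
(`HardyBound.improve`). As `p > 1`, some `k` makes `ε ≤ 1 / 2`; then `q < p` is chosen close to `p`.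
Iterating gives `u ≤ 2 C' d M`, once some finite `S` is available to start with
(`HardyBound.of_improve`), and one is if `g` is bounded below by a positive constant.

The Poincaré condition only concerns lower semicontinuous functions. Since the inequality is
pointwise in `x`, it is enough to replace `g` by a lower semicontinuous function whose maximal
function is almost the same at `x` alone (`exists_lowerSemicontinuous_majorant`). Such a function
need not dominate `g` at `x` itself, which is harmless because a curve parametrized by arc length
spends no time at a given point (`Curve.volume_arcParam_eq`).
-/

noncomputable section

namespace PointwiseHardy

open Filter Topology Metric

/-! ### Curves in arc length parametrization -/

section Curves

variable {X : Type*} [MetricSpace X]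

/-- The arc length parametrization of a curve, meaningful on `[0, length γ]`. -/
def Curve.arcParam (γ : Curve X) : ℝ → X :=
  naturalParameterization γ.toFun (Icc γ.a γ.b) γ.a

theorem Curve.left_mem (γ : Curve X) : γ.a ∈ Icc γ.a γ.b := ⟨le_rfl, γ.le⟩

theorem Curve.right_mem (γ : Curve X) : γ.b ∈ Icc γ.a γ.b := ⟨γ.le, le_rfl⟩

theorem Curve.length_nonneg (γ : Curve X) : 0 ≤ γ.length := ENNReal.toReal_nonneg

theorem Curve.variationOnFromTo_right (γ : Curve X) :
    variationOnFromTo γ.toFun (Icc γ.a γ.b) γ.a γ.b = γ.length := by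
  rw [variationOnFromTo.eq_of_le _ _ γ.le, inter_self, Curve.length]

theorem Curve.continuousOn_variationOnFromTo (γ : Curve X) :
    ContinuousOn (variationOnFromTo γ.toFun (Icc γ.a γ.b) γ.a) (Icc γ.a γ.b) := by
  intro x hx
  set s := Icc γ.a γ.b with hs
  have hbv := γ.rectifiable
  have hloc := hbv.locallyBoundedVariationOn
  have hcont := γ.continuousOn x hx
  have hl : Tendsto (fun y ↦ (eVariationOn γ.toFun (s ∩ Icc y x)).toReal) (𝓝[s] x) (𝓝 0) :=
    (ENNReal.tendsto_toReal ENNReal.zero_ne_top).comp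
      (hbv.tendsto_eVariationOn_Icc_zero_left (hcont.mono inter_subset_left))
  have hr : Tendsto (fun y ↦ (eVariationOn γ.toFun (s ∩ Icc x y)).toReal) (𝓝[s] x) (𝓝 0) :=
    (ENNReal.tendsto_toReal ENNReal.zero_ne_top).comp
      (hbv.tendsto_eVariationOn_Icc_zero_right x (hcont.mono inter_subset_left))
  have hlr := hl.add hr
  rw [add_zero] at hlr
  have hzero : Tendsto (variationOnFromTo γ.toFun s x) (𝓝[s] x) (𝓝 0) := by
    refine squeeze_zero_norm (fun y ↦ ?_) hlr
    rcases le_total x y with h | h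
    · rw [variationOnFromTo.eq_of_le _ _ h, Real.norm_of_nonneg ENNReal.toReal_nonneg]
      exact le_add_of_nonneg_left ENNReal.toReal_nonneg
    · rw [variationOnFromTo.eq_of_ge _ _ h, norm_neg, Real.norm_of_nonneg ENNReal.toReal_nonneg]
      exact le_add_of_nonneg_right ENNReal.toReal_nonneg
  have h2 := hzero.const_add (variationOnFromTo γ.toFun s γ.a x)
  rw [add_zero] at h2
  refine h2.congr' ?_
  filter_upwards [self_mem_nhdsWithin] with y hy
  exact variationOnFromTo.add hloc γ.left_mem hx hy

theorem Curve.Icc_subset_image_variationOnFromTo (γ : Curve X) :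
    Icc 0 γ.length ⊆ variationOnFromTo γ.toFun (Icc γ.a γ.b) γ.a '' Icc γ.a γ.b := by
  have h := intermediate_value_Icc γ.le γ.continuousOn_variationOnFromTo
  rwa [γ.variationOnFromTo_right, variationOnFromTo.self] at h

theorem Curve.arcParam_variationOnFromTo (γ : Curve X) {t : ℝ} (ht : t ∈ Icc γ.a γ.b) :
    γ.arcParam (variationOnFromTo γ.toFun (Icc γ.a γ.b) γ.a t) = γ.toFun t :=
  edist_eq_zero.1 (edist_naturalParameterization_eq_zero
    γ.rectifiable.locallyBoundedVariationOn γ.left_mem ht)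

theorem Curve.arcParam_zero (γ : Curve X) : γ.arcParam 0 = γ.source := by
  have h := γ.arcParam_variationOnFromTo γ.left_mem
  rwa [variationOnFromTo.self] at h

theorem Curve.arcParam_length (γ : Curve X) : γ.arcParam γ.length = γ.target := by
  have h := γ.arcParam_variationOnFromTo γ.right_mem
  rwa [γ.variationOnFromTo_right] at h

theorem Curve.lipschitzOnWith_arcParam (γ : Curve X) :
    LipschitzOnWith 1 γ.arcParam (Icc 0 γ.length) := by
  have hu := has_unit_speed_naturalParameterization γ.toFun
    γ.rectifiable.locallyBoundedVariationOn γ.left_mem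
  have key : ∀ x ∈ Icc 0 γ.length, ∀ y ∈ Icc 0 γ.length, x ≤ y →
      edist (γ.arcParam x) (γ.arcParam y) ≤ edist x y := by
    intro x hx y hy hxy
    have hx' := γ.Icc_subset_image_variationOnFromTo hx
    have hy' := γ.Icc_subset_image_variationOnFromTo hy
    refine (eVariationOn.edist_le _ (mem_inter hx' (left_mem_Icc.2 hxy))
      (mem_inter hy' (right_mem_Icc.2 hxy))).trans ?_
    refine (hu hx' hy').le.trans ?_
    rw [edist_dist, Real.dist_eq, abs_sub_comm, abs_of_nonneg (sub_nonneg.2 hxy)]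
    simp
  intro x hx y hy
  rw [ENNReal.coe_one, one_mul]
  rcases le_total x y with h | h
  · exact key x hx y hy h
  · rw [edist_comm, edist_comm x]
    exact key y hy x hx h

theorem Curve.ofReal_length_le (γ : Curve X) :
    ENNReal.ofReal γ.length ≤ eVariationOn γ.arcParam (Icc 0 γ.length) := by
  have hloc := γ.rectifiable.locallyBoundedVariationOn
  have h0 : ENNReal.ofReal γ.length = eVariationOn γ.toFun (Icc γ.a γ.b) :=
    ENNReal.ofReal_toReal γ.rectifiable
  set v := variationOnFromTo γ.toFun (Icc γ.a γ.b) γ.a with hv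
  have h1 : eVariationOn γ.toFun (Icc γ.a γ.b) = eVariationOn (γ.arcParam ∘ v) (Icc γ.a γ.b) :=
    eVariationOn.congr fun t ht ↦ (γ.arcParam_variationOnFromTo ht).symm
  rw [h0, h1]
  have hm : MonotoneOn v (Icc γ.a γ.b) := variationOnFromTo.monotoneOn hloc γ.left_mem
  refine eVariationOn.comp_le_of_monotoneOn _ _ hm fun t ht ↦ ⟨?_, ?_⟩
  · have := hm γ.left_mem ht ht.1
    rwa [hv, variationOnFromTo.self] at this
  · have := hm ht γ.right_mem ht.2
    rwa [hv, γ.variationOnFromTo_right] at this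

/-- A curve parametrized by arc length spends no time at a given point: cutting out the times
spent there leaves the length unchanged, and what remains has speed at most one. -/
theorem Curve.volume_arcParam_eq (γ : Curve X) (x : X) :
    volume {t ∈ Icc 0 γ.length | γ.arcParam t = x} = 0 := by
  set η := γ.arcParam with hη
  set ℓ := γ.length with hℓ
  have hlip : LipschitzOnWith 1 η (Icc 0 ℓ) := γ.lipschitzOnWith_arcParam
  set K := {t ∈ Icc 0 ℓ | η t = x} with hK
  have hKclosed : IsClosed K :=
    hlip.continuousOn.preimage_isClosed_of_isClosed isClosed_Icc isClosed_singleton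
  have hKfin : volume K ≠ ∞ :=
    ((measure_mono (sep_subset _ _)).trans_lt measure_Icc_lt_top).ne
  have hdist : ∀ s ∈ Icc 0 ℓ, ∀ t ∈ Icc 0 ℓ, s ≤ t → edist (η s) (η t) ≤ ENNReal.ofReal (t - s) := by
    intro s hs t ht hst
    have := hlip hs ht
    rwa [ENNReal.coe_one, one_mul, edist_dist s, Real.dist_eq, abs_sub_comm,
      abs_of_nonneg (sub_nonneg.2 hst)] at this
  have key : ∀ s ∈ Icc 0 ℓ, ∀ t ∈ Icc 0 ℓ, s ≤ t →
      edist (η s) (η t) ≤ volume (Icc s t \ K) := by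
    intro s hs t ht hst
    -- The first and the last visit to `x` in `[s, t]` are at distance zero from each other.
    rcases (Icc s t ∩ K).eq_empty_or_nonempty with he | hne
    · rw [sdiff_eq_left.2 (disjoint_iff_inter_eq_empty.2 he), Real.volume_Icc]
      exact hdist s hs t ht hst
    · have hc : IsCompact (Icc s t ∩ K) := isCompact_Icc.inter_right hKclosed
      obtain ⟨a, ha⟩ := hc.exists_isLeast hne
      obtain ⟨b, hb⟩ := hc.exists_isGreatest hne
      have hab : a ≤ b := ha.2 hb.1
      have hsub : Ico s a ∪ Ioc b t ⊆ Icc s t \ K := by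
        rintro z (hz | hz)
        · exact ⟨⟨hz.1, hz.2.le.trans ha.1.1.2⟩,
            fun hzK ↦ absurd (ha.2 ⟨⟨hz.1, hz.2.le.trans ha.1.1.2⟩, hzK⟩) (not_le.2 hz.2)⟩
        · exact ⟨⟨hb.1.1.1.trans hz.1.le, hz.2⟩,
            fun hzK ↦ absurd (hb.2 ⟨⟨hb.1.1.1.trans hz.1.le, hz.2⟩, hzK⟩) (not_le.2 hz.1)⟩
      have hdisj : Disjoint (Ico s a) (Ioc b t) :=
        Set.disjoint_left.2 fun z hz hz' ↦ absurd (hz'.1.trans hz.2) (not_lt.2 hab)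
      calc edist (η s) (η t)
          ≤ edist (η s) (η a) + edist (η a) (η t) := edist_triangle _ _ _
        _ = edist (η s) (η a) + edist (η b) (η t) := by rw [ha.1.2.2, hb.1.2.2]
        _ ≤ ENNReal.ofReal (a - s) + ENNReal.ofReal (t - b) :=
            add_le_add (hdist s hs a ha.1.2.1 ha.1.1.1) (hdist b hb.1.2.1 t ht hb.1.1.2)
        _ = volume (Ico s a ∪ Ioc b t) := by
            rw [measure_union hdisj measurableSet_Ioc, Real.volume_Ico, Real.volume_Ioc]
        _ ≤ volume (Icc s t \ K) := measure_mono hsub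
  have hvar : eVariationOn η (Icc 0 ℓ) ≤ volume (Icc 0 ℓ \ K) := by
    refine iSup_le fun ⟨n, u, hu, hus⟩ ↦ ?_
    have hI : ∀ i, edist (η (u (i + 1))) (η (u i)) ≤ volume (Ioc (u i) (u (i + 1)) \ K) := by
      intro i
      rw [edist_comm]
      refine (key _ (hus i) _ (hus (i + 1)) (hu i.le_succ)).trans ?_
      rw [← Ioc_insert_left (hu i.le_succ), insert_eq, union_sdiff_distrib]
      refine (measure_union_le _ _).trans ?_
      rw [measure_mono_null sdiff_subset Real.volume_singleton, zero_add]
    refine (Finset.sum_le_sum fun i _ ↦ hI i).trans ?_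
    rw [← measure_biUnion_finset]
    · refine measure_mono (iUnion₂_subset fun i _ ↦ sdiff_subset_sdiff_left ?_)
      exact fun z hz ↦ ⟨(hus i).1.trans hz.1.le, hz.2.trans (hus (i + 1)).2⟩
    · intro i _ j _ hij
      exact (hu.pairwise_disjoint_on_Ioc_succ hij).mono sdiff_subset sdiff_subset
    · exact fun i _ ↦ measurableSet_Ioc.diff hKclosed.measurableSet
  have hlen := γ.ofReal_length_le.trans hvar
  rw [measure_sdiff (sep_subset _ _) hKclosed.measurableSet.nullMeasurableSet hKfin,
    Real.volume_Icc, sub_zero] at hlen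
  by_contra h0
  rcases eq_or_ne (ENNReal.ofReal ℓ) 0 with hz | hz
  · refine h0 (measure_mono_null (sep_subset _ _) ?_)
    rw [Real.volume_Icc, sub_zero, hz]
  · exact absurd hlen (not_le.2 (ENNReal.sub_lt_self ENNReal.ofReal_ne_top hz h0))

end Curves

/-! ### Upper gradients -/

section UpperGradients

theorem abs_deriv_le_of_eventually {φ : ℝ → ℝ} {K : Set ℝ} {t c : ℝ}
    (hd : DifferentiableAt ℝ φ t) (hne : 𝓝[K ∩ Ioi t] t ≠ ⊥)
    (hc : ∀ᶠ s in 𝓝[K] t, |φ s - φ t| ≤ c * |s - t|) : |deriv φ t| ≤ c := by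
  have : (𝓝[K ∩ Ioi t] t).NeBot := ⟨hne⟩
  have hlim : Tendsto (slope φ t) (𝓝[K ∩ Ioi t] t) (𝓝 (deriv φ t)) :=
    (hasDerivAt_iff_tendsto_slope.1 hd.hasDerivAt).mono_left
      (nhdsWithin_mono _ fun s hs ↦ (ne_of_gt hs.2 : s ≠ t))
  refine le_of_tendsto hlim.abs ?_
  filter_upwards [hc.filter_mono (nhdsWithin_mono _ inter_subset_left), self_mem_nhdsWithin]
    with s hs hst
  have h0 : 0 < |s - t| := abs_pos.2 (sub_ne_zero.2 (ne_of_gt hst.2))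
  rwa [slope_def_field, abs_div, div_le_iff₀ h0]

variable {X : Type*} [MetricSpace X] [MeasurableSpace X]

/-- A Lipschitz function whose restrictions to `P` and to `Q` are locally `c`-Lipschitz has an
upper gradient equal to `c` on `P ∪ Q`: along a curve, almost every time spent in `P` is an
accumulation point of such times, so the derivative there is controlled by values on `P` only. -/
theorem isUpperGradient_of_locally_lipschitz {f : X → ℝ} {L c : ℝ≥0} (hf : LipschitzWith L f)
    {E P Q : Set X} (hE : MeasurableSet E) (hcover : Eᶜ ⊆ P ∪ Q)
    (hP : ∀ y ∈ P, ∀ᶠ z in 𝓝[P] y, |f z - f y| ≤ c * dist z y)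
    (hQ : ∀ y ∈ Q, ∀ᶠ z in 𝓝[Q] y, |f z - f y| ≤ c * dist z y) :
    IsUpperGradient (fun y ↦ c + E.indicator (fun _ ↦ L) y) f := by
  refine ⟨measurable_const.add (measurable_const.indicator hE), fun γ ↦ ?_⟩
  set η := γ.arcParam with hη
  set ℓ := γ.length with hℓ
  have hℓ0 : 0 ≤ ℓ := γ.length_nonneg
  have hlip : LipschitzOnWith 1 η (Icc 0 ℓ) := γ.lipschitzOnWith_arcParam
  set φ : ℝ → ℝ := fun t ↦ f (η t) with hφ
  have hφlip : LipschitzOnWith L φ (Icc 0 ℓ) := by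
    have := hf.comp_lipschitzOnWith hlip
    rwa [mul_one] at this
  have hac : AbsolutelyContinuousOnInterval φ 0 ℓ := by
    apply LipschitzOnWith.absolutelyContinuousOnInterval (K := L)
    rwa [uIcc_of_le hℓ0]
  have hftc := hac.integral_deriv_eq_sub
  have hbound : ∀ R : Set X, (∀ y ∈ R, ∀ᶠ z in 𝓝[R] y, |f z - f y| ≤ c * dist z y) →
      ∀ᵐ t, t ∈ Icc 0 ℓ → DifferentiableAt ℝ φ t → η t ∈ R → |deriv φ t| ≤ c := by
    intro R hR
    -- All but countably many points of `K` are limits of points of `K` from the right.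
    set K := {t ∈ Icc 0 ℓ | η t ∈ R} with hK
    have hcount := (countable_setOfPred_isolated_right_within (s := K)).ae_notMem volume
    filter_upwards [hcount] with t ht htI hd htR
    have htK : t ∈ K := ⟨htI, htR⟩
    refine abs_deriv_le_of_eventually (K := K) hd (fun h ↦ ht ⟨htK, h⟩) ?_
    have htend : Tendsto η (𝓝[K] t) (𝓝[R] (η t)) := by
      refine tendsto_nhdsWithin_iff.2 ⟨?_, ?_⟩
      · exact (hlip.continuousOn t htI).mono_left (nhdsWithin_mono _ (sep_subset _ _))
      · filter_upwards [self_mem_nhdsWithin] with s hs using hs.2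
    filter_upwards [htend.eventually (hR _ htR), self_mem_nhdsWithin] with s hs hsK
    refine hs.trans (mul_le_mul_of_nonneg_left ?_ c.2)
    have := hlip.dist_le_mul s hsK.1 t htI
    simpa [Real.dist_eq] using this
  have hends : ∀ᵐ t : ℝ, t ∉ ({0, ℓ} : Set ℝ) :=
    ((Set.countable_singleton ℓ).insert 0).ae_notMem volume
  have hae : ∀ᵐ t, t ∈ Icc 0 ℓ →
      ‖deriv φ t‖ₑ ≤ ((c + E.indicator (fun _ ↦ L) (η t) : ℝ≥0) : ℝ≥0∞) := by
    filter_upwards [hac.ae_differentiableAt, hbound P hP, hbound Q hQ, hends]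
      with t hdiff htP htQ hte htI
    have hd : DifferentiableAt ℝ φ t := by
      apply hdiff
      rwa [uIcc_of_le hℓ0]
    rw [enorm_le_coe, ← NNReal.coe_le_coe, coe_nnnorm, Real.norm_eq_abs, NNReal.coe_add]
    by_cases hEt : η t ∈ E
    · rw [indicator_of_mem hEt]
      have hnhds : Icc 0 ℓ ∈ 𝓝 t := by
        refine Icc_mem_nhds (lt_of_le_of_ne htI.1 ?_) (lt_of_le_of_ne htI.2 ?_)
        · exact fun h ↦ hte (by simp [← h])
        · exact fun h ↦ hte (by simp [h])
      have := norm_deriv_le_of_lipschitzOn hnhds hφlip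
      rw [Real.norm_eq_abs] at this
      linarith [c.2]
    · have h0 : (0 : ℝ) ≤ (E.indicator (fun _ ↦ L) (η t) : ℝ≥0) := NNReal.coe_nonneg _
      rcases hcover hEt with h | h
      · linarith [htP htI hd h]
      · linarith [htQ htI hd h]
  have hint : ENNReal.ofReal |f γ.source - f γ.target| = ‖∫ t in (0)..ℓ, deriv φ t‖ₑ := by
    rw [hftc, hφ]
    simp only [hη, hℓ, γ.arcParam_zero, γ.arcParam_length]
    rw [abs_sub_comm, ← Real.norm_eq_abs, ofReal_norm]
  rw [hint, intervalIntegral.integral_of_le hℓ0]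
  refine (enorm_integral_le_lintegral_enorm _).trans ?_
  refine (lintegral_mono_set Ioc_subset_Icc_self).trans ?_
  exact setLIntegral_mono_ae' measurableSet_Icc hae

theorem IsUpperGradient.add {g₁ g₂ : X → ℝ≥0} {u₁ u₂ : X → ℝ}
    (h₁ : IsUpperGradient g₁ u₁) (h₂ : IsUpperGradient g₂ u₂) :
    IsUpperGradient (fun x ↦ g₁ x + g₂ x) (fun x ↦ u₁ x + u₂ x) := by
  refine ⟨h₁.1.add h₂.1, fun γ ↦ ?_⟩
  have habs : |u₁ γ.source + u₂ γ.source - (u₁ γ.target + u₂ γ.target)| ≤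
      |u₁ γ.source - u₁ γ.target| + |u₂ γ.source - u₂ γ.target| := by
    rw [add_sub_add_comm]
    exact abs_add_le _ _
  refine (ENNReal.ofReal_le_ofReal habs).trans ?_
  rw [ENNReal.ofReal_add (abs_nonneg _) (abs_nonneg _)]
  refine (add_le_add (h₁.2 γ) (h₂.2 γ)).trans ?_
  simp only [Curve.lineIntegral, ENNReal.coe_add]
  exact le_lintegral_add _ _

theorem isUpperGradient_zero : IsUpperGradient (fun _ : X ↦ 0) (fun _ ↦ 0) :=
  ⟨measurable_const, fun γ ↦ by simp⟩

theorem IsUpperGradient.sum {ι : Type*} (s : Finset ι) {g : ι → X → ℝ≥0}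
    {u : ι → X → ℝ} (h : ∀ i ∈ s, IsUpperGradient (g i) (u i)) :
    IsUpperGradient (fun x ↦ ∑ i ∈ s, g i x) (fun x ↦ ∑ i ∈ s, u i x) := by
  classical
  induction s using Finset.induction_on with
  | empty => simpa using isUpperGradient_zero
  | insert a s ha ih =>
    simp only [Finset.sum_insert ha]
    exact (h a (Finset.mem_insert_self a s)).add
      (ih fun i hi ↦ h i (Finset.mem_insert_of_mem hi))

theorem IsUpperGradient.const_mul (a : ℝ≥0) {g : X → ℝ≥0} {u : X → ℝ}
    (h : IsUpperGradient g u) : IsUpperGradient (fun x ↦ a * g x) (fun x ↦ a * u x) := by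
  refine ⟨h.1.const_mul a, fun γ ↦ ?_⟩
  rw [← mul_sub, abs_mul, NNReal.abs_eq, ENNReal.ofReal_mul a.coe_nonneg, ENNReal.ofReal_coe_nnreal]
  refine (mul_le_mul_right (h.2 γ) _).trans ?_
  simp only [Curve.lineIntegral, ENNReal.coe_mul]
  exact lintegral_const_mul_le _ _

theorem IsUpperGradient.abs {g : X → ℝ≥0} {u : X → ℝ} (h : IsUpperGradient g u) :
    IsUpperGradient g (fun x ↦ |u x|) :=
  ⟨h.1, fun γ ↦ (ENNReal.ofReal_le_ofReal (abs_abs_sub_abs_le _ _)).trans (h.2 γ)⟩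

/-- Enlarging an upper gradient keeps the upper gradient property, and its value at a single point
is irrelevant, since curves spend no time there. -/
theorem IsUpperGradient.mono_off_point {g g' : X → ℝ≥0} {u : X → ℝ}
    (h : IsUpperGradient g u) (hg' : Measurable g') (x : X) (hle : ∀ y, y ≠ x → g y ≤ g' y) :
    IsUpperGradient g' u := by
  refine ⟨hg', fun γ ↦ (h.2 γ).trans ?_⟩
  refine setLIntegral_mono_ae' measurableSet_Icc ?_
  have hnull := measure_eq_zero_iff_ae_notMem.1 (γ.volume_arcParam_eq x)
  filter_upwards [hnull] with t ht htI
  exact ENNReal.coe_le_coe.2 (hle _ fun hx ↦ ht ⟨htI, hx⟩)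

end UpperGradients

/-! ### Lower semicontinuous majorants -/

section LowerSemicontinuousMajorant

variable {X : Type*} [MetricSpace X] [MeasurableSpace X] [BorelSpace X]

theorem lintegral_ball_le_of_lintegral_le {ρ : Measure X} {x : X} {r R : ℝ}
    (hrR : r ≤ R) {f h : X → ℝ≥0∞} (hle : h ≤ f) {ε : ℝ≥0∞}
    (hfin : ∫⁻ y in ball x R, h y ∂ρ ≠ ∞)
    (hint : ∫⁻ y in ball x R, f y ∂ρ ≤ ∫⁻ y in ball x R, h y ∂ρ + ε) :
    ∫⁻ y in ball x r, f y ∂ρ ≤ ∫⁻ y in ball x r, h y ∂ρ + ε := by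
  have hsplit : ∀ k : X → ℝ≥0∞, ∫⁻ y in ball x R, k y ∂ρ =
      ∫⁻ y in ball x r, k y ∂ρ + ∫⁻ y in ball x R \ ball x r, k y ∂ρ := by
    intro k
    rw [← lintegral_union (measurableSet_ball.diff measurableSet_ball) disjoint_sdiff_right,
      union_sdiff_cancel (ball_subset_ball hrR)]
  have hfin' : ∫⁻ y in ball x R \ ball x r, h y ∂ρ ≠ ∞ :=
    ((lintegral_mono_set sdiff_subset).trans_lt hfin.lt_top).ne
  refine (ENNReal.add_le_add_iff_right hfin').1 ?_
  calc ∫⁻ y in ball x r, f y ∂ρ + ∫⁻ y in ball x R \ ball x r, h y ∂ρ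
      ≤ ∫⁻ y in ball x r, f y ∂ρ + ∫⁻ y in ball x R \ ball x r, f y ∂ρ :=
        add_le_add le_rfl (lintegral_mono hle)
    _ = ∫⁻ y in ball x R, f y ∂ρ := (hsplit f).symm
    _ ≤ ∫⁻ y in ball x R, h y ∂ρ + ε := hint
    _ = _ := by rw [hsplit h]; ring

/-- A bounded Borel function has, away from a given point `x`, a lower semicontinuous majorant
whose means over all small balls centred at `x` are almost the same. The approximation is done
separately on dyadic annuli around `x`, with an error that is small compared with the measure of
a ball that does not meet the annulus. -/
theorem exists_lowerSemicontinuous_majorant {ρ : Measure X} (x : X)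
    (hfin : ∀ r, ρ (ball x r) < ∞) (hpos : ∀ r, 0 < r → 0 < ρ (ball x r))
    {q : ℝ} (hq : 0 < q) {g : X → ℝ≥0} (hg : Measurable g) {G : ℝ≥0} (hG : ∀ z, g z ≤ G)
    {R : ℝ} (hR : 0 < R) {δ : ℝ≥0} (hδ : 0 < δ) :
    ∃ g' : X → ℝ≥0, LowerSemicontinuous g' ∧ (∃ M : ℝ≥0, ∀ z, g' z ≤ M) ∧ (∀ z, δ ≤ g' z) ∧
      (∀ z, z ≠ x → g z ≤ g' z) ∧ ∀ r, r ≤ R →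
        ∫⁻ y in ball x r, (g' y : ℝ≥0∞) ^ q ∂ρ ≤
          ∫⁻ y in ball x r, (g y : ℝ≥0∞) ^ q ∂ρ + 2 * δ ^ q * ρ (ball x r) := by
  set h : X → ℝ≥0∞ := fun y ↦ (g y : ℝ≥0∞) ^ q with hh
  have hhm : Measurable h := (hg.coe_nnreal_ennreal).pow_const q
  set C : ℝ≥0∞ := ((max G δ : ℝ≥0) : ℝ≥0∞) ^ q with hC
  have hCtop : C ≠ ∞ := ENNReal.rpow_ne_top_of_nonneg hq.le ENNReal.coe_ne_top
  have hhC : ∀ y, h y ≤ C := fun y ↦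
    ENNReal.rpow_le_rpow (ENNReal.coe_le_coe.2 ((hG y).trans (le_max_left _ _))) hq.le
  have hδq : (δ : ℝ≥0∞) ^ q ≠ 0 := by
    simp [hδ.ne']
  obtain ⟨ε, hε0, hεsum⟩ := ENNReal.exists_pos_sum_of_countable hδq ℕ
  -- `disjointed S` is the decomposition of the complement of `x` into dyadic annuli, the
  -- outermost one being unbounded.
  set S : ℕ → Set X := fun n ↦ {y | R * (1 / 2) ^ (n + 1) ≤ dist y x} with hS
  have hSm : ∀ n, MeasurableSet (S n) := fun n ↦
    (isClosed_le continuous_const (continuous_id.dist continuous_const)).measurableSet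
  set U : ℕ → Set X := fun n ↦ {y | R * (1 / 2) ^ (n + 2) < dist y x} with hU
  have hUo : ∀ n, IsOpen (U n) := fun n ↦
    isOpen_lt continuous_const (continuous_id.dist continuous_const)
  have hSU : ∀ n, S n ⊆ U n := fun n y hy ↦ by
    have hy' : R * (1 / 2) ^ (n + 1) ≤ dist y x := hy
    refine lt_of_lt_of_le (b := R * (1 / 2) ^ (n + 1)) ?_ hy'
    exact mul_lt_mul_of_pos_left
      (pow_lt_pow_right_of_lt_one₀ (by norm_num) (by norm_num) (Nat.lt_succ_self _)) hR
  set A : ℕ → Set X := disjointed S with hA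
  have hAm : ∀ n, MeasurableSet (A n) := fun n ↦ MeasurableSet.disjointed hSm n
  have hAS : ∀ n, A n ⊆ S n := fun n ↦ disjointed_subset S n
  have hcover : ∀ z, z ≠ x → ∃ n, z ∈ A n := by
    intro z hz
    have hd : 0 < dist z x := dist_pos.2 hz
    obtain ⟨n, hn⟩ := exists_pow_lt_of_lt_one (div_pos hd hR) (by norm_num : (1 / 2 : ℝ) < 1)
    have hzS : z ∈ ⋃ n, S n := by
      refine mem_iUnion.2 ⟨n, ?_⟩
      rw [lt_div_iff₀ hR] at hn
      have h2 : (1 / 2 : ℝ) ^ (n + 1) ≤ (1 / 2) ^ n :=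
        pow_le_pow_of_le_one (by norm_num) (by norm_num) n.le_succ
      calc R * (1 / 2) ^ (n + 1) ≤ R * (1 / 2) ^ n := mul_le_mul_of_nonneg_left h2 hR.le
        _ ≤ dist z x := by linarith
    rw [← iUnion_disjointed] at hzS
    exact mem_iUnion.1 hzS
  have : IsFiniteMeasure (ρ.restrict (ball x R)) := ⟨by simpa using hfin R⟩
  have hex : ∀ n, ∃ f : X → ℝ≥0∞, (A n).indicator h ≤ f ∧ LowerSemicontinuous f ∧
      ∫⁻ y in ball x R, f y ∂ρ ≤ ∫⁻ y in ball x R, (A n).indicator h y ∂ρ +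
        ε n * ρ (ball x (R * (1 / 2) ^ (n + 2))) := by
    intro n
    have hne : (ε n : ℝ≥0∞) * ρ (ball x (R * (1 / 2) ^ (n + 2))) ≠ 0 :=
      mul_ne_zero (by simpa using (hε0 n).ne') (hpos _ (by positivity)).ne'
    obtain ⟨f, hf1, hf2, hf3⟩ := exists_le_lowerSemicontinuous_lintegral_ge
      (ρ.restrict (ball x R)) ((A n).indicator h) (hhm.indicator (hAm n)) hne
    exact ⟨f, fun y ↦ hf1 y, hf2, hf3⟩
  choose f hfle hflsc hfint using hex
  set F : ℕ → X → ℝ≥0∞ := fun n y ↦ f n y ⊓ (U n).indicator (fun _ ↦ ∞) y with hF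
  have hFlsc : ∀ n, LowerSemicontinuous (F n) := fun n ↦
    (hflsc n).inf ((hUo n).lowerSemicontinuous_indicator (by simp))
  set T : X → ℝ≥0∞ := fun y ↦ max (δ ^ q : ℝ≥0∞) (min C (∑' n, F n y)) with hT
  have hTlsc : LowerSemicontinuous T :=
    lowerSemicontinuous_const.sup (lowerSemicontinuous_const.inf (lowerSemicontinuous_tsum hFlsc))
  have hTC : ∀ y, T y ≤ C := fun y ↦ max_le
    (ENNReal.rpow_le_rpow (ENNReal.coe_le_coe.2 (le_max_right _ _)) hq.le) (min_le_left _ _)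
  have hq1 : 0 < 1 / q := by positivity
  have hroot : ∀ a : ℝ≥0∞, (a ^ q) ^ (1 / q) = a := fun a ↦ by
    rw [← ENNReal.rpow_mul, mul_one_div_cancel hq.ne', ENNReal.rpow_one]
  have hroot' : ∀ a : ℝ≥0∞, (a ^ (1 / q)) ^ q = a := fun a ↦ by
    rw [← ENNReal.rpow_mul, one_div_mul_cancel hq.ne', ENNReal.rpow_one]
  have hTtop : ∀ y, T y ^ (1 / q) ≠ ∞ := fun y ↦
    ENNReal.rpow_ne_top_of_nonneg hq1.le ((hTC y).trans_lt hCtop.lt_top).ne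
  have hcoe : ∀ y, (((T y ^ (1 / q)).toNNReal : ℝ≥0) : ℝ≥0∞) = T y ^ (1 / q) := fun y ↦
    ENNReal.coe_toNNReal (hTtop y)
  refine ⟨fun y ↦ (T y ^ (1 / q)).toNNReal, ?_, ⟨max G δ, fun z ↦ ?_⟩, fun z ↦ ?_, fun z hz ↦ ?_,
    fun r hr ↦ ?_⟩
  · intro y t ht
    have hlsc : LowerSemicontinuous fun y ↦ T y ^ (1 / q) :=
      ENNReal.continuous_rpow_const.comp_lowerSemicontinuous hTlsc
        (ENNReal.monotone_rpow_of_nonneg hq1.le)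
    have ht' : (t : ℝ≥0∞) < T y ^ (1 / q) := by
      rw [← hcoe]; exact ENNReal.coe_lt_coe.2 ht
    filter_upwards [hlsc y _ ht'] with z hz
    rw [← hcoe] at hz
    exact ENNReal.coe_lt_coe.1 hz
  · rw [← ENNReal.coe_le_coe, hcoe, ← hroot (max G δ : ℝ≥0)]
    exact ENNReal.rpow_le_rpow (hTC z) hq1.le
  · rw [← ENNReal.coe_le_coe, hcoe, ← hroot δ]
    exact ENNReal.rpow_le_rpow (le_max_left _ _) hq1.le
  · rw [← ENNReal.coe_le_coe, hcoe, ← hroot (g z)]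
    refine ENNReal.rpow_le_rpow (le_max_of_le_right (le_min (hhC z) ?_)) hq1.le
    obtain ⟨n, hn⟩ := hcover z hz
    refine le_trans ?_ (ENNReal.le_tsum n)
    have h1 := hfle n z
    rw [indicator_of_mem hn] at h1
    simpa [hF, indicator_of_mem (hSU n (hAS n hn))] using h1
  · have hsmall : ∀ n, ∫⁻ y in ball x r, F n y ∂ρ ≤
        ∫⁻ y in ball x r, (A n).indicator h y ∂ρ + ε n * ρ (ball x r) := by
      intro n
      -- Either the ball does not meet `U n`, or its measure dominates the error on the annulus.
      rcases le_or_gt r (R * (1 / 2) ^ (n + 2)) with hrn | hrn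
      · have hz : ∀ y ∈ ball x r, F n y = 0 := fun y hy ↦ by
          have : y ∉ U n := fun hyU ↦ absurd (hy.trans_le hrn) (not_lt.2 (le_of_lt hyU))
          simp [hF, indicator_of_notMem this]
        rw [setLIntegral_congr_fun measurableSet_ball hz]
        simp
      · have hAfin : ∫⁻ y in ball x R, (A n).indicator h y ∂ρ ≠ ∞ := by
          refine ((lintegral_mono fun y ↦ ?_ : _ ≤ ∫⁻ _ in ball x R, C ∂ρ).trans_lt ?_).ne
          · exact (indicator_le_self _ _ _).trans (hhC y)
          · rw [setLIntegral_const]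
            exact ENNReal.mul_lt_top hCtop.lt_top (hfin R)
        calc ∫⁻ y in ball x r, F n y ∂ρ ≤ ∫⁻ y in ball x r, f n y ∂ρ :=
              lintegral_mono fun y ↦ inf_le_left
          _ ≤ ∫⁻ y in ball x r, (A n).indicator h y ∂ρ +
              ε n * ρ (ball x (R * (1 / 2) ^ (n + 2))) :=
              lintegral_ball_le_of_lintegral_le hr (hfle n) hAfin (hfint n)
          _ ≤ _ := by
              gcongr
    have hAsum : ∑' n, ∫⁻ y in ball x r, (A n).indicator h y ∂ρ ≤ ∫⁻ y in ball x r, h y ∂ρ := by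
      have h1 : ∀ n, ∫⁻ y in ball x r, (A n).indicator h y ∂ρ =
          ∫⁻ y in A n, h y ∂(ρ.restrict (ball x r)) := fun n ↦ lintegral_indicator (hAm n) _
      simp only [h1]
      rw [← lintegral_iUnion hAm (disjoint_disjointed S)]
      exact setLIntegral_le_lintegral _ _
    calc ∫⁻ y in ball x r, (((T y ^ (1 / q)).toNNReal : ℝ≥0) : ℝ≥0∞) ^ q ∂ρ
        = ∫⁻ y in ball x r, T y ∂ρ := by simp only [hcoe, hroot']
      _ ≤ ∫⁻ y in ball x r, ((∑' n, F n y) + δ ^ q) ∂ρ := lintegral_mono fun y ↦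
          max_le le_add_self ((min_le_right _ _).trans le_self_add)
      _ = (∑' n, ∫⁻ y in ball x r, F n y ∂ρ) + δ ^ q * ρ (ball x r) := by
          rw [lintegral_add_right _ measurable_const, setLIntegral_const,
            lintegral_tsum fun n ↦ (hFlsc n).measurable.aemeasurable]
      _ ≤ (∑' n, (∫⁻ y in ball x r, (A n).indicator h y ∂ρ + ε n * ρ (ball x r))) +
          δ ^ q * ρ (ball x r) := by
          gcongr with n
          exact hsmall n
      _ = (∑' n, ∫⁻ y in ball x r, (A n).indicator h y ∂ρ) + (∑' n, (ε n : ℝ≥0∞)) * ρ (ball x r) +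
          δ ^ q * ρ (ball x r) := by rw [ENNReal.tsum_add, ENNReal.tsum_mul_right]
      _ ≤ ∫⁻ y in ball x r, h y ∂ρ + δ ^ q * ρ (ball x r) + δ ^ q * ρ (ball x r) := by
          gcongr
      _ = ∫⁻ y in ball x r, h y ∂ρ + 2 * δ ^ q * ρ (ball x r) := by ring

end LowerSemicontinuousMajorant

/-! ### Maximal functions: semicontinuity and a weak type estimate -/

section MaximalMeans

variable {X : Type*} [MetricSpace X] [MeasurableSpace X]

/-- The `L^q` mean `(ρ(B)⁻¹ ∫_B f^q dρ)^{1/q}` over the ball `B = B(x, r)`. -/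
def ballMean (ρ : Measure X) (q : ℝ) (f : X → ℝ≥0∞) (x : X) (r : ℝ) : ℝ≥0∞ :=
  ((∫⁻ y in ball x r, f y ^ q ∂ρ) / ρ (ball x r)) ^ (1 / q)

/-- The supremum of the `L^q` means of `f` over the balls centred at `x` of radius less than `R`.
With `ρ = w dμ` both maximal functions of the statement have this form. -/
def maxMean (ρ : Measure X) (q : ℝ) (f : X → ℝ≥0∞) (x : X) (R : ℝ) : ℝ≥0∞ :=
  ⨆ (r : ℝ) (_ : 0 < r ∧ r < R), ballMean ρ q f x r

variable {ρ : Measure X} {q : ℝ} {f : X → ℝ≥0∞} {x : X} {r R : ℝ}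

theorem ballMean_le_maxMean (hr : 0 < r) (hrR : r < R) :
    ballMean ρ q f x r ≤ maxMean ρ q f x R :=
  le_iSup₂_of_le r ⟨hr, hrR⟩ le_rfl

theorem maxMean_mono {R' : ℝ} (hR : R ≤ R') : maxMean ρ q f x R ≤ maxMean ρ q f x R' :=
  iSup₂_le fun _ hr ↦ ballMean_le_maxMean hr.1 (hr.2.trans_le hR)

theorem ballMean_le_iff (hq : 0 < q) (h0 : 0 < ρ (ball x r)) (hfin : ρ (ball x r) < ∞)
    {t : ℝ≥0∞} :
    ballMean ρ q f x r ≤ t ↔ ∫⁻ y in ball x r, f y ^ q ∂ρ ≤ t ^ q * ρ (ball x r) := by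
  rw [ballMean, one_div, ENNReal.rpow_inv_le_iff hq, ENNReal.div_le_iff h0.ne' hfin.ne]

theorem ballMean_le_const (hq : 0 < q) (h0 : 0 < ρ (ball x r)) (hfin : ρ (ball x r) < ∞)
    {t : ℝ≥0∞} (hf : ∀ y, f y ≤ t) : ballMean ρ q f x r ≤ t := by
  rw [ballMean_le_iff hq h0 hfin, ← setLIntegral_const]
  exact lintegral_mono fun y ↦ ENNReal.rpow_le_rpow (hf y) hq.le

theorem maxMean_le_const (hq : 0 < q) (h0 : ∀ r, 0 < r → 0 < ρ (ball x r))
    (hfin : ∀ r, ρ (ball x r) < ∞) {t : ℝ≥0∞} (hf : ∀ y, f y ≤ t) : maxMean ρ q f x R ≤ t :=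
  iSup₂_le fun r hr ↦ ballMean_le_const hq (h0 r hr.1) (hfin r) hf

theorem const_le_maxMean (hq : 0 < q) (h0 : ∀ r, 0 < r → 0 < ρ (ball x r))
    (hfin : ∀ r, ρ (ball x r) < ∞) {t : ℝ≥0∞} (hf : ∀ y, t ≤ f y) (hR : 0 < R) :
    t ≤ maxMean ρ q f x R := by
  refine le_trans ?_ (ballMean_le_maxMean (half_pos hR) (half_lt_self hR))
  have hr := half_pos hR
  rw [ballMean, one_div, ENNReal.le_rpow_inv_iff hq,
    ENNReal.le_div_iff_mul_le (Or.inl (h0 _ hr).ne') (Or.inl (hfin _).ne), ← setLIntegral_const]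
  exact lintegral_mono fun y ↦ ENNReal.rpow_le_rpow (hf y) hq.le

theorem setLIntegral_le_of_maxMean_le (hq : 0 < q) (h0 : ∀ r, 0 < r → 0 < ρ (ball x r))
    (hfin : ∀ r, ρ (ball x r) < ∞) {t : ℝ≥0∞} (ht : maxMean ρ q f x R ≤ t)
    (hr : 0 < r) (hrR : r < R) : ∫⁻ y in ball x r, f y ^ q ∂ρ ≤ t ^ q * ρ (ball x r) :=
  (ballMean_le_iff hq (h0 r hr) (hfin r)).1 ((ballMean_le_maxMean hr hrR).trans ht)

theorem exists_of_lt_maxMean (hq : 0 < q) (h0 : ∀ r, 0 < r → 0 < ρ (ball x r))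
    (hfin : ∀ r, ρ (ball x r) < ∞) {t : ℝ≥0∞} (ht : t < maxMean ρ q f x R) :
    ∃ r, 0 < r ∧ r < R ∧ t ^ q * ρ (ball x r) < ∫⁻ y in ball x r, f y ^ q ∂ρ := by
  obtain ⟨r, hr⟩ := lt_iSup_iff.1 ht
  obtain ⟨hr0, hr⟩ := lt_iSup_iff.1 hr
  refine ⟨r, hr0.1, hr0.2, ?_⟩
  by_contra hcon
  exact absurd ((ballMean_le_iff hq (h0 r hr0.1) (hfin r)).2 (not_lt.1 hcon)) (not_le.2 hr)

theorem lt_maxMean_of_lt (hq : 0 < q) (h0 : ∀ r, 0 < r → 0 < ρ (ball x r))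
    (hfin : ∀ r, ρ (ball x r) < ∞) {t : ℝ≥0∞} (hr : 0 < r) (hrR : r < R)
    (h : t ^ q * ρ (ball x r) < ∫⁻ y in ball x r, f y ^ q ∂ρ) : t < maxMean ρ q f x R := by
  refine lt_of_lt_of_le ?_ (ballMean_le_maxMean hr hrR)
  by_contra hcon
  exact absurd ((ballMean_le_iff hq (h0 r hr) (hfin r)).1 (not_lt.1 hcon)) (not_le.2 h)

theorem ballMean_mono_exponent {p : ℝ} (hp : 0 < p) (hpq : p ≤ q) (hf : Measurable f)
    (h0 : 0 < ρ (ball x r)) (hfin : ρ (ball x r) < ∞) :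
    ballMean ρ p f x r ≤ ballMean ρ q f x r := by
  have hq : 0 < q := hp.trans_le hpq
  have : NeZero (ρ.restrict (ball x r)) := ⟨by simpa using h0.ne'⟩
  have : IsFiniteMeasure (ρ.restrict (ball x r)) := ⟨by simpa using hfin⟩
  set ν := (ρ (ball x r))⁻¹ • ρ.restrict (ball x r) with hν
  have hνp : IsProbabilityMeasure ν := ⟨by
    simp [hν, ENNReal.inv_mul_cancel h0.ne' hfin.ne]⟩
  have key : ∀ s : ℝ, 0 < s → ballMean ρ s f x r = eLpNorm f (ENNReal.ofReal s) ν := by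
    intro s hs
    rw [eLpNorm_eq_lintegral_rpow_enorm_toReal (by simpa using hs) ENNReal.ofReal_ne_top,
      ENNReal.toReal_ofReal hs.le, hν, lintegral_smul_measure, ballMean, smul_eq_mul,
      ENNReal.div_eq_inv_mul]
    simp
  rw [key p hp, key q hq]
  exact eLpNorm_le_eLpNorm_of_exponent_le (ENNReal.ofReal_le_ofReal hpq)
    hf.aestronglyMeasurable

theorem maxMean_mono_exponent {p R' : ℝ} (hp : 0 < p) (hpq : p ≤ q) (hf : Measurable f)
    (h0 : ∀ r, 0 < r → 0 < ρ (ball x r)) (hfin : ∀ r, ρ (ball x r) < ∞) (hR : R ≤ R') :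
    maxMean ρ p f x R ≤ maxMean ρ q f x R' :=
  iSup₂_le fun r hr ↦ (ballMean_mono_exponent hp hpq hf (h0 r hr.1) (hfin r)).trans
    (ballMean_le_maxMean hr.1 (hr.2.trans_le hR))

variable [BorelSpace X]

/-- Superlevel sets of the maximal function are open, for a continuously varying bound `R y` on
the radii: the mean over a ball only decreases a little when the radius is slightly reduced in the
numerator but not in the denominator, which leaves room for moving the centre. -/
theorem isOpen_lt_maxMean {Ω : Set X} (hΩ : IsOpen Ω) (hq : 0 < q)
    (h0 : ∀ x ∈ Ω, ∀ r, 0 < r → 0 < ρ (ball x r)) (hfin : ∀ x r, ρ (ball x r) < ∞)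
    {R : X → ℝ} (hR : Continuous R) (t : ℝ≥0∞) :
    IsOpen {y ∈ Ω | t < maxMean ρ q f y (R y)} := by
  rw [isOpen_iff_mem_nhds]
  rintro y ⟨hyΩ, hy⟩
  obtain ⟨r, hr, hrR, hlt⟩ := exists_of_lt_maxMean hq (h0 y hyΩ) (hfin y) hy
  set ν := ρ.withDensity fun z ↦ f z ^ q with hν
  have hνB : ∀ z s, ν (ball z s) = ∫⁻ y in ball z s, f y ^ q ∂ρ := fun z s ↦
    withDensity_apply _ measurableSet_ball
  rw [← hνB] at hlt
  have hball : ball y r = ⋃ n : ℕ, ball y (r - 1 / ((n : ℝ) + 1)) := by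
    refine Subset.antisymm (fun z hz ↦ ?_) (iUnion_subset fun n ↦ ball_subset_ball ?_)
    · obtain ⟨n, hn⟩ := exists_nat_one_div_lt (sub_pos.2 (mem_ball.1 hz))
      exact mem_iUnion.2 ⟨n, mem_ball.2 (by linarith)⟩
    · have : 0 < 1 / ((n : ℝ) + 1) := by positivity
      linarith
  have hmono : Monotone fun n : ℕ ↦ ball y (r - 1 / ((n : ℝ) + 1)) := fun m n hmn ↦
    ball_subset_ball (sub_le_sub_left (Nat.one_div_le_one_div hmn) _)
  obtain ⟨n, hn⟩ : ∃ n : ℕ, t ^ q * ρ (ball y r) < ν (ball y (r - 1 / ((n : ℝ) + 1))) := by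
    have hν' : ν (ball y r) = ⨆ n : ℕ, ν (ball y (r - 1 / ((n : ℝ) + 1))) :=
      (congrArg ν hball).trans hmono.measure_iUnion
    rw [hν'] at hlt
    exact lt_iSup_iff.1 hlt
  set r' := r - 1 / ((n : ℝ) + 1) with hr'
  have hr'r : r' < r := by
    have : 0 < 1 / ((n : ℝ) + 1) := by positivity
    linarith
  have hr'0 : 0 < r' := by
    by_contra hcon
    rw [ball_eq_empty.2 (not_lt.1 hcon), measure_empty] at hn
    exact absurd hn not_lt_zero
  have hnear : ∀ᶠ z in 𝓝 y, dist z y < (r - r') / 2 :=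
    ball_mem_nhds y (by linarith)
  have hRz : ∀ᶠ z in 𝓝 y, r < R z := hR.continuousAt.eventually (lt_mem_nhds hrR)
  filter_upwards [hΩ.mem_nhds hyΩ, hnear, hRz] with z hzΩ hzy hzR
  refine ⟨hzΩ, lt_maxMean_of_lt (r := (r + r') / 2) hq (h0 z hzΩ) (hfin z) (by linarith)
    (by linarith) ?_⟩
  rw [← hνB]
  calc t ^ q * ρ (ball z ((r + r') / 2)) ≤ t ^ q * ρ (ball y r) := by
        gcongr
        exact ball_subset_ball' (by linarith)
    _ < ν (ball y r') := hn
    _ ≤ ν (ball z ((r + r') / 2)) :=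
        measure_mono (ball_subset_ball' (by rw [dist_comm]; linarith))

/-- A weak type estimate on the ball `B(x, r)`. Balls of radius at least `r` cannot contribute to
the superlevel set, since their means are controlled by the maximal function at `x`. The other
ones stay inside `B(x, 2r)`, and a Vitali covering applies. -/
theorem measure_lt_maxMean_le {Ω : Set X} (hq : 0 < q)
    (h0 : ∀ x ∈ Ω, ∀ r, 0 < r → 0 < ρ (ball x r)) (hfin : ∀ x r, ρ (ball x r) < ∞)
    {d : X → ℝ} {κ : ℝ} {D : ℝ≥0∞}
    (hD : ∀ y ∈ Ω, ∀ s, 0 < s → s ≤ 4 * κ * d y → ρ (ball y s) ≤ D * ρ (ball y (s / 2)))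
    (hx : x ∈ Ω) (hr : 0 < r) (hrκ : 2 * r < κ * d x) {τ t : ℝ≥0∞} (hτ0 : τ ≠ 0) (hτ : τ ≠ ∞)
    (hM : maxMean ρ q f x (κ * d x) ≤ τ) (htD : D ^ 2 ≤ t ^ q) :
    t ^ q * ρ (ball x r ∩ {y ∈ Ω | t * τ < maxMean ρ q f y (min (κ * d y) (κ * d x / 4))}) ≤
      D ^ 3 * ρ (ball x r) := by
  set E := ball x r ∩ {y ∈ Ω | t * τ < maxMean ρ q f y (min (κ * d y) (κ * d x / 4))} with hE
  have hD4 : ∀ y ∈ Ω, ∀ s, 0 < s → s ≤ κ * d y → ρ (ball y (4 * s)) ≤ D ^ 2 * ρ (ball y s) := by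
    intro y hy s hs hsκ
    calc ρ (ball y (4 * s)) ≤ D * ρ (ball y (4 * s / 2)) := hD y hy _ (by linarith) (by linarith)
      _ ≤ D * (D * ρ (ball y (4 * s / 2 / 2))) := by
          gcongr
          exact hD y hy _ (by linarith) (by linarith)
      _ = D ^ 2 * ρ (ball y s) := by
          rw [show 4 * s / 2 / 2 = s by ring]; ring
  have hτq0 : τ ^ q ≠ 0 := by
    simp [ENNReal.rpow_eq_zero_iff, hτ0, hτ]
  have hτq : τ ^ q ≠ ∞ := ENNReal.rpow_ne_top_of_nonneg hq.le hτ
  have hex : ∀ y ∈ E, ∃ s, 0 < s ∧ s < r ∧ s ≤ κ * d y ∧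
      (t * τ) ^ q * ρ (ball y s) < ∫⁻ z in ball y s, f z ^ q ∂ρ := by
    rintro y ⟨hyx, hyΩ, hy⟩
    obtain ⟨s, hs, hsR, hlt⟩ := exists_of_lt_maxMean hq (h0 y hyΩ) (hfin y) hy
    rw [lt_min_iff] at hsR
    refine ⟨s, hs, ?_, hsR.1.le, hlt⟩
    -- For `s ≥ r` the ball `B(y, s)` is comparable with `B(x, 2 s)`.
    by_contra hcon
    have hrs : r ≤ s := not_lt.1 hcon
    have hyx' : dist y x < r := hyx
    refine absurd hlt (not_lt.2 ?_)
    calc ∫⁻ z in ball y s, f z ^ q ∂ρ ≤ ∫⁻ z in ball x (2 * s), f z ^ q ∂ρ :=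
          lintegral_mono_set (ball_subset_ball' (by linarith))
      _ ≤ τ ^ q * ρ (ball x (2 * s)) :=
          setLIntegral_le_of_maxMean_le hq (h0 x hx) (hfin x) hM (by linarith) (by linarith)
      _ ≤ τ ^ q * ρ (ball y (4 * s)) := by
          gcongr
          exact ball_subset_ball' (by rw [dist_comm]; linarith)
      _ ≤ τ ^ q * (D ^ 2 * ρ (ball y s)) := by
          gcongr
          exact hD4 y hyΩ s hs hsR.1.le
      _ ≤ τ ^ q * (t ^ q * ρ (ball y s)) := by gcongr
      _ = (t * τ) ^ q * ρ (ball y s) := by rw [ENNReal.mul_rpow_of_nonneg _ _ hq.le]; ring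
  choose! s hs0 hsr hsκ hslt using hex
  obtain ⟨u, huE, hdisj, hcov⟩ := Vitali.exists_disjoint_subfamily_covering_enlargement_ball
    E (fun y ↦ y) s r (fun y hy ↦ (hsr y hy).le) 4 (by norm_num)
  have hsub : ⋃ b ∈ u, ball b (s b) ⊆ ball x (2 * r) := by
    refine iUnion₂_subset fun b hb ↦ ball_subset_ball' ?_
    have : dist b x < r := (huE hb).1
    linarith [hsr b (huE hb)]
  have hucount : u.Countable := by
    have hc := Measure.countable_meas_pos_of_disjoint_of_meas_iUnion_ne_top ρ
      (As := fun b : u ↦ ball (b : X) (s b)) (fun b ↦ measurableSet_ball)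
      (fun a b hab ↦ hdisj a.2 b.2 (fun h ↦ hab (Subtype.ext h)))
      (by
        rw [iUnion_subtype (· ∈ u) (fun b ↦ ball (b : X) (s b))]
        exact ((measure_mono hsub).trans_lt (hfin _ _)).ne)
    have hall : {i : u | 0 < ρ (ball (i : X) (s i))} = univ := eq_univ_of_forall fun b ↦
      h0 b (huE b.2).2.1 _ (hs0 b (huE b.2))
    rw [hall] at hc
    exact countable_coe_iff.1 (countable_univ_iff.1 hc)
  have hmain : (t * τ) ^ q * ρ E ≤ D ^ 3 * ρ (ball x r) * τ ^ q := by
    calc (t * τ) ^ q * ρ E ≤ (t * τ) ^ q * ρ (⋃ b ∈ u, ball b (4 * s b)) := by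
          gcongr
          intro y hy
          obtain ⟨b, hb, hsubset⟩ := hcov y hy
          exact mem_iUnion₂.2 ⟨b, hb, hsubset (mem_ball_self (hs0 y hy))⟩
      _ ≤ (t * τ) ^ q * ∑' b : u, ρ (ball (b : X) (4 * s b)) := by
          gcongr
          exact measure_biUnion_le ρ hucount _
      _ ≤ (t * τ) ^ q * ∑' b : u, D ^ 2 * ρ (ball (b : X) (s b)) := by
          gcongr with b
          exact hD4 b (huE b.2).2.1 _ (hs0 b (huE b.2)) (hsκ b (huE b.2))
      _ = D ^ 2 * ∑' b : u, (t * τ) ^ q * ρ (ball (b : X) (s b)) := by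
          rw [ENNReal.tsum_mul_left, ENNReal.tsum_mul_left]; ring
      _ ≤ D ^ 2 * ∑' b : u, ∫⁻ z in ball (b : X) (s b), f z ^ q ∂ρ := by
          gcongr with b
          exact (hslt b (huE b.2)).le
      _ = D ^ 2 * ∫⁻ z in ⋃ b ∈ u, ball b (s b), f z ^ q ∂ρ := by
          rw [lintegral_biUnion hucount (fun b _ ↦ measurableSet_ball) hdisj]
      _ ≤ D ^ 2 * ∫⁻ z in ball x (2 * r), f z ^ q ∂ρ := by
          gcongr
      _ ≤ D ^ 2 * (τ ^ q * ρ (ball x (2 * r))) := by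
          gcongr
          exact setLIntegral_le_of_maxMean_le hq (h0 x hx) (hfin x) hM (by linarith) hrκ
      _ ≤ D ^ 2 * (τ ^ q * (D * ρ (ball x (2 * r / 2)))) := by
          gcongr
          exact hD x hx _ (by linarith) (by linarith)
      _ = D ^ 3 * ρ (ball x r) * τ ^ q := by
          rw [show 2 * r / 2 = r by ring]; ring
  rw [ENNReal.mul_rpow_of_nonneg _ _ hq.le, mul_right_comm] at hmain
  exact (ENNReal.mul_le_mul_iff_left hτq0 hτq).1 hmain

end MaximalMeans

/-! ### Lipschitz extension from the good set -/

section LipschitzExtension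

variable {X : Type*} [MetricSpace X]

theorem lipZero_add {Ω : Set X} {u v : X → ℝ} (hu : u ∈ LipZero Ω) (hv : v ∈ LipZero Ω) :
    (fun x ↦ u x + v x) ∈ LipZero Ω := by
  obtain ⟨⟨K, hK⟩, hu0⟩ := hu
  obtain ⟨⟨K', hK'⟩, hv0⟩ := hv
  exact ⟨⟨K + K', hK.add hK'⟩, fun x hx ↦ by simp [hu0 x hx, hv0 x hx]⟩

theorem lipZero_const_mul {Ω : Set X} (a : ℝ) {u : X → ℝ} (hu : u ∈ LipZero Ω) :
    (fun x ↦ a * u x) ∈ LipZero Ω := by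
  obtain ⟨⟨K, hK⟩, hu0⟩ := hu
  exact ⟨⟨‖a‖₊ * K, (lipschitzWith_smul a).comp hK⟩, fun x hx ↦ by simp [hu0 x hx]⟩

theorem lipZero_sum {Ω : Set X} {ι : Type*} (s : Finset ι) {u : ι → X → ℝ}
    (hu : ∀ i ∈ s, u i ∈ LipZero Ω) : (fun x ↦ ∑ i ∈ s, u i x) ∈ LipZero Ω := by
  classical
  induction s using Finset.induction_on with
  | empty => exact ⟨⟨0, by simp⟩, fun x _ ↦ by simp⟩
  | insert a s ha ih =>
    simp only [Finset.sum_insert ha]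
    exact lipZero_add (hu a (Finset.mem_insert_self a s))
      (ih fun i hi ↦ hu i (Finset.mem_insert_of_mem hi))

theorem lipZero_abs {Ω : Set X} {u : X → ℝ} (hu : u ∈ LipZero Ω) :
    (fun x ↦ |u x|) ∈ LipZero Ω := by
  obtain ⟨⟨K, hK⟩, hu0⟩ := hu
  refine ⟨⟨K, LipschitzWith.of_dist_le_mul fun x y ↦ ?_⟩, fun x hx ↦ by simp [hu0 x hx]⟩
  exact (abs_abs_sub_abs_le (u x) (u y)).trans (hK.dist_le_mul x y)

/-- A function that decays linearly at the boundary of `Ω`, and is Lipschitz at scales that are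
small compared with the distance to the boundary, is Lipschitz. -/
theorem lipschitzOnWith_compl_union {Ω F : Set X} {v : X → ℝ} (hv : ∀ y, 0 ≤ v y)
    (hv0 : ∀ y ∈ Ωᶜ, v y = 0) {a b κ c : ℝ≥0} (hκ : 0 < κ) (hc : 3 * κ + 1 ≤ c)
    (hdecay : ∀ y ∈ F, v y ≤ a * infDist y Ωᶜ)
    (hlocal : ∀ y ∈ F, ∀ z ∈ F, dist y z < infDist y Ωᶜ / (3 * κ) →
      |v y - v z| ≤ b * dist y z) :
    LipschitzOnWith (b + c * a) v (Ωᶜ ∪ F) := by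
  have hκ' : (0 : ℝ) < κ := hκ
  have hc' : 3 * (κ : ℝ) + 1 ≤ c := by exact_mod_cast hc
  have hb0 : (0 : ℝ) ≤ b := b.2
  have ha0 : (0 : ℝ) ≤ a := a.2
  have hbd : ∀ y ∈ F, ∀ z ∈ Ωᶜ, v y ≤ (b + c * a) * dist y z := by
    intro y hy z hz
    have h1 := hdecay y hy
    have h2 : infDist y Ωᶜ ≤ dist y z := infDist_le_dist_of_mem hz
    have h3 : (a : ℝ) * infDist y Ωᶜ ≤ a * dist y z := mul_le_mul_of_nonneg_left h2 ha0
    have h4 : 0 ≤ a * dist y z := mul_nonneg ha0 dist_nonneg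
    have h5 : 0 ≤ b * dist y z := mul_nonneg hb0 dist_nonneg
    nlinarith [mul_le_mul_of_nonneg_right (by linarith : (1 : ℝ) ≤ c) h4]
  refine LipschitzOnWith.of_dist_le_mul fun y hy z hz ↦ ?_
  rw [Real.dist_eq, NNReal.coe_add, NNReal.coe_mul]
  rcases hy with hy | hy <;> rcases hz with hz | hz
  · rw [hv0 y hy, hv0 z hz, sub_self, abs_zero]
    positivity
  · rw [hv0 y hy, zero_sub, abs_neg, abs_of_nonneg (hv z), dist_comm]
    exact hbd z hz y hy
  · rw [hv0 z hz, sub_zero, abs_of_nonneg (hv y)]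
    exact hbd y hy z hz
  · rcases lt_or_ge (dist y z) (infDist y Ωᶜ / (3 * κ)) with h | h
    · refine (hlocal y hy z hz h).trans ?_
      have : (0 : ℝ) ≤ c * a * dist y z := by positivity
      linarith
    · rw [div_le_iff₀ (by positivity)] at h
      have hz' : infDist z Ωᶜ ≤ infDist y Ωᶜ + dist z y := infDist_le_infDist_add_dist
      rw [dist_comm] at hz'
      have h0 : (0 : ℝ) ≤ dist y z := dist_nonneg
      have hcd : (3 * (κ : ℝ) + 1) * dist y z ≤ c * dist y z := mul_le_mul_of_nonneg_right hc' h0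
      have hy1 : v y ≤ a * (c * dist y z) :=
        (hdecay y hy).trans (mul_le_mul_of_nonneg_left (by linarith) ha0)
      have hz1 : v z ≤ a * (c * dist y z) :=
        (hdecay z hz).trans (mul_le_mul_of_nonneg_left (by linarith) ha0)
      have hb1 : 0 ≤ b * dist y z := mul_nonneg hb0 h0
      have := hv y
      have := hv z
      rw [abs_le]
      constructor <;> nlinarith

/-- The McShane extension of such a function from `Ωᶜ ∪ F` has slope at most `b` on that set, and
the global Lipschitz constant is needed only on the complement. -/
theorem exists_extension_isUpperGradient [MeasurableSpace X] {Ω F : Set X} (hΩ : IsOpen Ω)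
    (hΩne : Ωᶜ.Nonempty) (hFΩ : F ⊆ Ω)
    (hF : MeasurableSet (Ωᶜ ∪ F)ᶜ) {v : X → ℝ} (hv : ∀ y, 0 ≤ v y)
    (hv0 : ∀ y ∈ Ωᶜ, v y = 0) {a b κ c : ℝ≥0} (hκ : 0 < κ) (hc : 3 * κ + 1 ≤ c)
    (hdecay : ∀ y ∈ F, v y ≤ a * infDist y Ωᶜ)
    (hlocal : ∀ y ∈ F, ∀ z ∈ F, dist y z < infDist y Ωᶜ / (3 * κ) →
      |v y - v z| ≤ b * dist y z) :
    ∃ f ∈ LipZero Ω, EqOn v f F ∧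
      IsUpperGradient (fun y ↦ b + (Ωᶜ ∪ F)ᶜ.indicator (fun _ ↦ b + c * a) y) f := by
  obtain ⟨f, hf, hvf⟩ :=
    (lipschitzOnWith_compl_union hv hv0 hκ hc hdecay hlocal).extend_real
  have hf0 : ∀ y ∈ Ωᶜ, f y = 0 := fun y hy ↦ by rw [← hvf (Or.inl hy), hv0 y hy]
  have hvfF : EqOn v f F := fun y hy ↦ hvf (Or.inr hy)
  refine ⟨f, ⟨⟨_, hf⟩, hf0⟩, hvfF, ?_⟩
  refine isUpperGradient_of_locally_lipschitz (P := Ωᶜ) (Q := F) hf hF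
    (by rw [compl_compl]) (fun y hy ↦ ?_) (fun y hy ↦ ?_)
  · filter_upwards [self_mem_nhdsWithin] with z hz
    rw [hf0 y hy, hf0 z hz, sub_self, abs_zero]
    positivity
  · have hd : 0 < infDist y Ωᶜ :=
      (hΩ.isClosed_compl.notMem_iff_infDist_pos hΩne).1 (not_not.2 (hFΩ hy))
    have hκ' : (0 : ℝ) < κ := hκ
    have hnear : ∀ᶠ z in 𝓝[F] y, dist z y < infDist y Ωᶜ / (3 * κ) :=
      mem_nhdsWithin_of_mem_nhds (ball_mem_nhds y (by positivity))
    filter_upwards [hnear, self_mem_nhdsWithin] with z hz hzF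
    rw [dist_comm] at hz
    have := hlocal y hy z hzF hz
    rwa [hvfF hy, hvfF hzF, abs_sub_comm, dist_comm] at this

end LipschitzExtension

/-! ### Sums over levels -/

section LayeredSums

/-- A sum of distinct powers of `t ≥ 2` is comparable with its largest term. -/
theorem sum_indicator_rpow_le {X : Type*} {t : ℝ≥0} (ht : 2 ≤ t) {p : ℝ} (hp : 0 < p)
    (E : ℕ → Set X) (y : X) (k : ℕ) :
    (∑ i ∈ Finset.range k, (E i).indicator (fun _ ↦ (t : ℝ≥0∞) ^ (i + 1)) y) ^ p ≤
      2 ^ p * ∑ i ∈ Finset.range k, (E i).indicator (fun _ ↦ ((t : ℝ≥0∞) ^ (i + 1)) ^ p) y := by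
  have ht' : (2 : ℝ≥0∞) ≤ t := by exact_mod_cast ht
  have hgeom : ∀ n : ℕ, ∑ i ∈ Finset.range (n + 1), (t : ℝ≥0∞) ^ (i + 1) ≤ 2 * t ^ (n + 1) := by
    intro n
    induction n with
    | zero =>
      simp only [zero_add, Finset.range_one, Finset.sum_singleton, pow_one]
      exact le_mul_of_one_le_left' (by norm_num)
    | succ n ih =>
      rw [Finset.sum_range_succ, two_mul]
      gcongr
      refine ih.trans ?_
      rw [pow_succ' (t : ℝ≥0∞) (n + 1)]
      gcongr
  induction k with
  | zero => simp [hp]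
  | succ k ih =>
    by_cases hy : y ∈ E k
    · calc (∑ i ∈ Finset.range (k + 1), (E i).indicator (fun _ ↦ (t : ℝ≥0∞) ^ (i + 1)) y) ^ p
          ≤ (2 * t ^ (k + 1)) ^ p := by
            refine ENNReal.rpow_le_rpow ((Finset.sum_le_sum fun i _ ↦ ?_).trans (hgeom k)) hp.le
            exact indicator_le_self _ _ _
        _ = 2 ^ p * (E k).indicator (fun _ ↦ ((t : ℝ≥0∞) ^ (k + 1)) ^ p) y := by
            rw [indicator_of_mem hy, ENNReal.mul_rpow_of_nonneg _ _ hp.le]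
        _ ≤ _ := by
            gcongr
            exact Finset.single_le_sum
              (f := fun i ↦ (E i).indicator (fun _ ↦ ((t : ℝ≥0∞) ^ (i + 1)) ^ p) y)
              (fun i _ ↦ zero_le) (Finset.self_mem_range_succ k)
    · rw [Finset.sum_range_succ, Finset.sum_range_succ, indicator_of_notMem hy,
        indicator_of_notMem hy, add_zero, add_zero]
      exact ih

theorem setLIntegral_sum_indicator_rpow_le {X : Type*} [MeasurableSpace X] {ρ : Measure X}
    {t : ℝ≥0} (ht : 2 ≤ t) {p q : ℝ} (hq : 0 < q) (hqp : q ≤ p) {E : ℕ → Set X}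
    (hE : ∀ i, MeasurableSet (E i)) {B : Set X} {k : ℕ} {C : ℝ≥0∞}
    (hEB : ∀ i < k, ((t : ℝ≥0∞) ^ (i + 1)) ^ q * ρ (B ∩ E i) ≤ C)
    (htk : (t : ℝ≥0∞) ^ (k * (p - q)) ≤ 2) :
    ∫⁻ y in B, (∑ i ∈ Finset.range k, (E i).indicator (fun _ ↦ (t : ℝ≥0∞) ^ (i + 1)) y) ^ p ∂ρ ≤
      2 ^ p * (2 * k * C) := by
  have hp : 0 < p := hq.trans_le hqp
  have ht0 : (t : ℝ≥0∞) ≠ 0 := by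
    have : 0 < t := lt_of_lt_of_le (by norm_num) ht
    simpa using this.ne'
  have ht1 : (1 : ℝ≥0∞) ≤ t := by
    exact_mod_cast (by norm_num : (1 : ℝ≥0) ≤ 2).trans ht
  have hterm : ∀ i ∈ Finset.range k, ∫⁻ y in B,
      (E i).indicator (fun _ ↦ ((t : ℝ≥0∞) ^ (i + 1)) ^ p) y ∂ρ ≤ 2 * C := by
    intro i hi
    have hik := Finset.mem_range.1 hi
    rw [lintegral_indicator_const (hE i), Measure.restrict_apply (hE i), inter_comm]
    have hsplit : ((t : ℝ≥0∞) ^ (i + 1)) ^ p =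
        (t : ℝ≥0∞) ^ (((i + 1 : ℕ) : ℝ) * (p - q)) * ((t : ℝ≥0∞) ^ (i + 1)) ^ q := by
      rw [← ENNReal.rpow_natCast, ← ENNReal.rpow_mul, ← ENNReal.rpow_mul,
        ← ENNReal.rpow_add _ _ ht0 ENNReal.coe_ne_top]
      congr 1
      ring
    rw [hsplit, mul_assoc]
    refine mul_le_mul' (le_trans ?_ htk) (hEB i hik)
    refine ENNReal.rpow_le_rpow_of_exponent_le ht1 ?_
    exact mul_le_mul_of_nonneg_right (by exact_mod_cast hik) (sub_nonneg.2 hqp)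
  calc ∫⁻ y in B, (∑ i ∈ Finset.range k, (E i).indicator (fun _ ↦ (t : ℝ≥0∞) ^ (i + 1)) y) ^ p ∂ρ
      ≤ ∫⁻ y in B, 2 ^ p * ∑ i ∈ Finset.range k,
          (E i).indicator (fun _ ↦ ((t : ℝ≥0∞) ^ (i + 1)) ^ p) y ∂ρ :=
        lintegral_mono fun y ↦ sum_indicator_rpow_le ht hp E y k
    _ = 2 ^ p * ∑ i ∈ Finset.range k, ∫⁻ y in B,
          (E i).indicator (fun _ ↦ ((t : ℝ≥0∞) ^ (i + 1)) ^ p) y ∂ρ := by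
        have hm : ∀ i, Measurable ((E i).indicator (fun _ ↦ ((t : ℝ≥0∞) ^ (i + 1)) ^ p)) :=
          fun i ↦ measurable_const.indicator (hE i)
        rw [lintegral_const_mul _ (Finset.measurable_fun_sum _ fun i _ ↦ hm i),
          lintegral_finsetSum _ fun i _ ↦ hm i]
    _ ≤ 2 ^ p * ∑ i ∈ Finset.range k, 2 * C := by
        gcongr with i hi
        exact hterm i hi
    _ = 2 ^ p * (2 * k * C) := by
        rw [Finset.sum_const, Finset.card_range, nsmul_eq_mul]; ring

end LayeredSums

/-! ### The bootstrap -/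

section SelfImprovement

variable {X : Type*} [MetricSpace X] [MeasurableSpace X]

theorem ballMean_add_mul_le {ρ : Measure X} {p : ℝ} (hp : 1 ≤ p) {x : X} {r : ℝ}
    (h0 : 0 < ρ (ball x r)) (hfin : ρ (ball x r) < ∞) {h Z : X → ℝ≥0∞} {α β η : ℝ≥0∞}
    (hβ : β ≠ ∞) (hle : ∀ y, h y ≤ α + β * Z y)
    (hZ : ∫⁻ y in ball x r, Z y ^ p ∂ρ ≤ η ^ p * ρ (ball x r)) :
    ballMean ρ p h x r ≤ 2 * (α + β * η) := by
  have hp0 : 0 < p := by linarith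
  rw [ballMean_le_iff hp0 h0 hfin]
  calc ∫⁻ y in ball x r, h y ^ p ∂ρ
      ≤ ∫⁻ y in ball x r, 2 ^ (p - 1) * (α ^ p + β ^ p * Z y ^ p) ∂ρ := by
        refine lintegral_mono fun y ↦ ?_
        refine (ENNReal.rpow_le_rpow (hle y) hp0.le).trans ?_
        rw [← ENNReal.mul_rpow_of_nonneg _ _ hp0.le]
        exact ENNReal.rpow_add_le_mul_rpow_add_rpow _ _ hp
    _ = 2 ^ (p - 1) * (α ^ p * ρ (ball x r) + β ^ p * ∫⁻ y in ball x r, Z y ^ p ∂ρ) := by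
        rw [lintegral_const_mul' _ _ (by simp), lintegral_add_left measurable_const,
          setLIntegral_const, lintegral_const_mul' _ _ (ENNReal.rpow_ne_top_of_nonneg hp0.le hβ)]
    _ ≤ 2 ^ p * (α ^ p * ρ (ball x r) + β ^ p * (η ^ p * ρ (ball x r))) := by
        gcongr
        · norm_num
        · linarith
    _ = 2 ^ p * (α ^ p + (β * η) ^ p) * ρ (ball x r) := by
        rw [ENNReal.mul_rpow_of_nonneg _ _ hp0.le]; ring
    _ ≤ 2 ^ p * (α + β * η) ^ p * ρ (ball x r) := by
        gcongr
        exact ENNReal.add_rpow_le_rpow_add _ _ hp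
    _ = (2 * (α + β * η)) ^ p * ρ (ball x r) := by
        rw [ENNReal.mul_rpow_of_nonneg _ _ hp0.le]

/-- The pointwise Hardy inequality of exponent `q` for a single pair `(u, g)`, with constant `S`
and means with respect to `ρ`. -/
def HardyBound (ρ : Measure X) (Ω : Set X) (q κ : ℝ) (u : X → ℝ) (g : X → ℝ≥0) (S : ℝ≥0) : Prop :=
  ∀ y ∈ Ω, ∀ s : ℝ≥0, maxMean ρ q (fun z ↦ (g z : ℝ≥0∞)) y (κ * infDist y Ωᶜ) ≤ s →
    u y ≤ S * s * infDist y Ωᶜ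

variable [BorelSpace X]

/-- The good part of `Ω` near `x`, where the maximal function of `g` is at most `s`, is a set on
which the truncation `min u (u x)` is Lipschitz with a constant proportional to `s`. The
truncation is what gives linear decay at the points `y` for which the bound on the radii in the
maximal function is not `κ d(y, Ωᶜ)`. The extension then has an upper gradient that does not
involve `g`. -/
theorem exists_truncated_extension {Ω : Set X} (hΩ : IsOpen Ω) (hΩc : Ωᶜ.Nonempty)
    {ρ : Measure X} (h0 : ∀ x ∈ Ω, ∀ r, 0 < r → 0 < ρ (ball x r))
    (hfin : ∀ x r, ρ (ball x r) < ∞) {q : ℝ} (hq : 0 < q) {κP b : ℝ≥0} (hκP : 1 ≤ κP)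
    {κH κ : ℝ} (hκH : 0 < κH) (hκ : 2 * (1 + κH) ≤ κ) {u : X → ℝ} (hu : u ∈ LipZero Ω)
    (hu0 : ∀ y, 0 ≤ u y) {g : X → ℝ≥0}
    (hloc : ∀ y ∈ Ω, ∀ z ∈ Ω, dist y z < infDist y Ωᶜ / (3 * κP) → ∀ s : ℝ≥0,
      maxMean ρ q (fun z ↦ (g z : ℝ≥0∞)) y (infDist y Ωᶜ / 2) ≤ s →
      maxMean ρ q (fun z ↦ (g z : ℝ≥0∞)) z (infDist y Ωᶜ / 2) ≤ s →
      |u y - u z| ≤ b * s * dist y z)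
    {S : ℝ≥0} (hS : HardyBound ρ Ω q κ u g S) {x : X} (hx : x ∈ Ω) {τ s : ℝ≥0}
    (hτ : maxMean ρ q (fun z ↦ (g z : ℝ≥0∞)) x (κ * infDist x Ωᶜ) ≤ τ) (hτs : τ ≤ s) :
    ∃ f ∈ LipZero Ω, ∃ E : Set X, MeasurableSet E ∧ f x = u x ∧
      IsUpperGradient
        (fun y ↦ b * s + E.indicator (fun _ ↦ b * s + (3 * κP + 1) * (4 * S * s)) y) f ∧
      ball x (κH * infDist x Ωᶜ) ∩ E ⊆ {y ∈ Ω | (s : ℝ≥0∞) <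
        maxMean ρ q (fun z ↦ (g z : ℝ≥0∞)) y
          (min (κ * infDist y Ωᶜ) (κ * infDist x Ωᶜ / 4))} := by
  set d : X → ℝ := fun y ↦ infDist y Ωᶜ with hd
  have hdpos : ∀ y ∈ Ω, 0 < d y := fun y hy ↦
    (hΩ.isClosed_compl.notMem_iff_infDist_pos hΩc).1 (not_not.2 hy)
  have hdx := hdpos x hx
  have hdcont : Continuous d := continuous_infDist_pt _
  set R : X → ℝ := fun y ↦ min (κ * d y) (κ * d x / 4) with hR
  set m : X → ℝ≥0∞ := fun y ↦ maxMean ρ q (fun z ↦ (g z : ℝ≥0∞)) y (R y) with hm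
  set F : Set X := {y ∈ Ω | dist y x < κH * d x ∧ m y ≤ s} with hF
  have hFΩ : F ⊆ Ω := sep_subset _ _
  have hcompl : (Ωᶜ ∪ F)ᶜ = {y ∈ Ω | (s : ℝ≥0∞) < m y} ∪ (Ω \ ball x (κH * d x)) := by
    ext y
    simp only [hF, mem_compl_iff, mem_union, mem_ofPred_eq, Set.mem_sdiff, mem_ball, not_or,
      not_not, not_and, not_le, not_lt]
    constructor
    · rintro ⟨hy, h⟩
      rcases lt_or_ge (dist y x) (κH * d x) with h' | h'
      · exact Or.inl ⟨hy, h hy h'⟩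
      · exact Or.inr ⟨hy, h'⟩
    · rintro (⟨hy, h⟩ | ⟨hy, h⟩)
      · exact ⟨hy, fun _ _ ↦ h⟩
      · exact ⟨hy, fun _ h' ↦ absurd h' (not_lt.2 h)⟩
  have hEm : MeasurableSet (Ωᶜ ∪ F)ᶜ := by
    rw [hcompl]
    refine (isOpen_lt_maxMean hΩ hq h0 hfin ?_ _).measurableSet.union
      (hΩ.measurableSet.diff measurableSet_ball)
    exact (continuous_const.mul hdcont).min continuous_const
  set v : X → ℝ := fun y ↦ min (u y) (u x) with hv
  have hv0 : ∀ y, 0 ≤ v y := fun y ↦ le_min (hu0 y) (hu0 x)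
  have hvc : ∀ y ∈ Ωᶜ, v y = 0 := fun y hy ↦ by
    simp [hv, hu.2 y hy, hu0 x]
  have hκ0 : 0 < κ := by linarith
  have hκP' : (1 : ℝ) ≤ κP := hκP
  have hκPpos : (0 : ℝ) < κP := by linarith
  have hux : u x ≤ S * s * d x := by
    refine (hS x hx τ hτ).trans ?_
    have : (τ : ℝ) ≤ s := hτs
    have hS0 : (0 : ℝ) ≤ S := S.2
    gcongr
  have hdecay : ∀ y ∈ F, v y ≤ (4 * S * s : ℝ≥0) * infDist y Ωᶜ := by
    rintro y ⟨hy, -, hmy⟩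
    have hSs : (0 : ℝ) ≤ S * s := by positivity
    have hdy := hdpos y hy
    push_cast
    change v y ≤ 4 * S * s * d y
    -- Near the boundary the bound `κ d x / 4` on the radii is void. Elsewhere `d x < 4 d y`.
    rcases le_or_gt (d y) (d x / 4) with h | h
    · have hRy : R y = κ * d y := min_eq_left (by nlinarith)
      have h1 : u y ≤ S * s * d y := by
        refine hS y hy s ?_
        change maxMean ρ q (fun z ↦ (g z : ℝ≥0∞)) y (R y) ≤ s at hmy
        rwa [hRy] at hmy
      have h2 : v y ≤ u y := min_le_left _ _
      nlinarith
    · have h2 : v y ≤ u x := min_le_right _ _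
      nlinarith
  have hlocal : ∀ y ∈ F, ∀ z ∈ F, dist y z < infDist y Ωᶜ / (3 * κP) →
      |v y - v z| ≤ (b * s : ℝ≥0) * dist y z := by
    rintro y ⟨hy, hyx, hmy⟩ z ⟨hz, -, hmz⟩ hyz
    change dist y z < d y / (3 * κP) at hyz
    have hdy := hdpos y hy
    have hdyx : d y ≤ d x + dist y x := infDist_le_infDist_add_dist
    have hdyz : d y ≤ d z + dist y z := infDist_le_infDist_add_dist
    have hyz' : dist y z ≤ d y / 3 := by
      refine hyz.le.trans ?_
      gcongr
      linarith
    have hRy : d y / 2 ≤ R y := le_min (by nlinarith) (by nlinarith)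
    have hRz : d y / 2 ≤ R z := le_min (by nlinarith) (by nlinarith)
    have h1 := hloc y hy z hz hyz s ((maxMean_mono hRy).trans hmy) ((maxMean_mono hRz).trans hmz)
    have h2 : |v y - v z| ≤ |u y - u z| := by
      have := abs_min_sub_min_le_max (u y) (u x) (u z) (u x)
      simpa using this
    push_cast
    exact h2.trans h1
  obtain ⟨f, hf, hvf, hfg⟩ := exists_extension_isUpperGradient hΩ hΩc hFΩ hEm hv0 hvc
    (a := 4 * S * s) (b := b * s) (c := 3 * κP + 1) (zero_lt_one.trans_le hκP) le_rfl hdecay hlocal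
  refine ⟨f, hf, (Ωᶜ ∪ F)ᶜ, hEm, ?_, hfg, ?_⟩
  · have hxF : x ∈ F := by
      refine ⟨hx, by rw [dist_self]; positivity, ?_⟩
      exact (maxMean_mono (min_le_left _ _)).trans (hτ.trans (by exact_mod_cast hτs))
    rw [← hvf hxF]
    exact min_self _
  · rintro y ⟨hyB, hyE⟩
    rw [hcompl] at hyE
    rcases hyE with hyE | hyE
    · exact hyE
    · exact absurd hyB hyE.2

/-- The bootstrap: if `(u, g)` satisfies the `q`-Hardy inequality with constant `S`, then the
`p`-Hardy inequality, applied to the average of the extensions at `k` consecutive levels of the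
maximal function, gives it with the constant `C + ε S`, where `ε` is small if `θ` is. -/
theorem HardyBound.improve {Ω : Set X} (hΩ : IsOpen Ω) (hΩc : Ωᶜ.Nonempty)
    {ρ : Measure X} (h0 : ∀ x ∈ Ω, ∀ r, 0 < r → 0 < ρ (ball x r))
    (hfin : ∀ x r, ρ (ball x r) < ∞) {p q : ℝ} (hq : 1 ≤ q) (hqp : q ≤ p)
    {κP b CH D t θ : ℝ≥0} (hκP : 1 ≤ κP) {κH κ : ℝ} (hκH : 0 < κH) (hκ : 2 * (1 + κH) ≤ κ)
    (hH : ∀ v ∈ LipZero Ω, ∀ h : X → ℝ≥0, IsUpperGradient h v → (∃ M : ℝ≥0, ∀ z, h z ≤ M) →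
      ∀ x ∈ Ω, ENNReal.ofReal |v x| ≤ CH * ENNReal.ofReal (infDist x Ωᶜ) *
        maxMean ρ p (fun z ↦ (h z : ℝ≥0∞)) x (κH * infDist x Ωᶜ))
    (hD : ∀ y ∈ Ω, ∀ s, 0 < s → s ≤ 4 * κ * infDist y Ωᶜ →
      ρ (ball y s) ≤ D * ρ (ball y (s / 2)))
    (ht : 2 ≤ t) (htD : D ^ 2 ≤ t) {k : ℕ} (hk : 0 < k) (htk : (t : ℝ≥0∞) ^ (k * (p - q)) ≤ 2)
    (hθ : 2 * (2 * k * D ^ 3) ^ (1 / p) ≤ k * θ)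
    {u : X → ℝ} (hu : u ∈ LipZero Ω) (hu0 : ∀ y, 0 ≤ u y) {g : X → ℝ≥0} {δ : ℝ≥0} (hδ : 0 < δ)
    (hg : ∀ y, δ ≤ g y)
    (hloc : ∀ y ∈ Ω, ∀ z ∈ Ω, dist y z < infDist y Ωᶜ / (3 * κP) → ∀ s : ℝ≥0,
      maxMean ρ q (fun z ↦ (g z : ℝ≥0∞)) y (infDist y Ωᶜ / 2) ≤ s →
      maxMean ρ q (fun z ↦ (g z : ℝ≥0∞)) z (infDist y Ωᶜ / 2) ≤ s →
      |u y - u z| ≤ b * s * dist y z)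
    {S : ℝ≥0} (hS : HardyBound ρ Ω q κ u g S) :
    HardyBound ρ Ω q κ u g
      (2 * CH * (b * t ^ k + θ * b) + 8 * CH * θ * (3 * κP + 1) * S) := by
  intro x hx τ hτ
  have hq0 : 0 < q := by linarith
  have hp1 : 1 ≤ p := hq.trans hqp
  have hp0 : 0 < p := by linarith
  have hκ0 : 0 < κ := by linarith
  have hdx : 0 < infDist x Ωᶜ :=
    (hΩ.isClosed_compl.notMem_iff_infDist_pos hΩc).1 (not_not.2 hx)
  have ht1 : 1 ≤ t := le_trans (by norm_num) ht
  have hk0 : (k : ℝ≥0) ≠ 0 := by exact_mod_cast hk.ne'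
  have hτpos : 0 < τ := by
    have h1 : (δ : ℝ≥0∞) ≤ τ := le_trans (const_le_maxMean hq0 (h0 x hx) (hfin x)
      (fun y ↦ ENNReal.coe_le_coe.2 (hg y)) (by positivity)) hτ
    exact hδ.trans_le (by exact_mod_cast h1)
  have hlevel : ∀ i : ℕ, τ ≤ t ^ (i + 1) * τ := fun i ↦
    le_mul_of_one_le_left' (one_le_pow₀ ht1)
  choose f hf E hEm hfx hfg hEsub using fun i : ℕ ↦ exists_truncated_extension hΩ hΩc h0 hfin hq0
    hκP hκH hκ hu hu0 hloc hS hx hτ (hlevel i)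
  set L : ℝ≥0 := b + (3 * κP + 1) * (4 * S) with hL
  set G : ℕ → X → ℝ≥0 := fun i y ↦ b * (t ^ (i + 1) * τ) + (E i).indicator
    (fun _ ↦ b * (t ^ (i + 1) * τ) + (3 * κP + 1) * (4 * S * (t ^ (i + 1) * τ))) y with hG
  set h : X → ℝ≥0 := fun y ↦ (k : ℝ≥0)⁻¹ * ∑ i ∈ Finset.range k, G i y with hh
  set V : X → ℝ := fun y ↦ ((k : ℝ≥0)⁻¹ : ℝ≥0) * ∑ i ∈ Finset.range k, f i y with hV
  have hVlip : V ∈ LipZero Ω := lipZero_const_mul _ (lipZero_sum _ fun i _ ↦ hf i)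
  have hVg : IsUpperGradient h V :=
    (IsUpperGradient.sum (Finset.range k) fun i _ ↦ hfg i).const_mul _
  have hVx : V x = u x := by
    simp only [hV, hfx, Finset.sum_const, Finset.card_range, nsmul_eq_mul]
    have : (k : ℝ) ≠ 0 := by exact_mod_cast hk.ne'
    push_cast
    field_simp
  have hGle : ∀ i ∈ Finset.range k, ∀ y, G i y ≤
      b * t ^ k * τ + L * τ * (E i).indicator (fun _ ↦ t ^ (i + 1)) y := by
    intro i hi y
    have hik : t ^ (i + 1) ≤ t ^ k := pow_le_pow_right₀ ht1 (Finset.mem_range.1 hi)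
    refine add_le_add ?_ ?_
    · rw [← mul_assoc]
      gcongr
    · by_cases hy : y ∈ E i
      · rw [indicator_of_mem hy, indicator_of_mem hy, hL]
        exact le_of_eq (by ring)
      · rw [indicator_of_notMem hy]
        exact zero_le
  set Z : X → ℝ≥0∞ := fun y ↦
    ∑ i ∈ Finset.range k, (E i).indicator (fun _ ↦ (t : ℝ≥0∞) ^ (i + 1)) y with hZ
  have hhle' : ∀ y, h y ≤ b * t ^ k * τ + (k : ℝ≥0)⁻¹ * (L * τ) *
      ∑ i ∈ Finset.range k, (E i).indicator (fun _ ↦ t ^ (i + 1)) y := by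
    intro y
    calc h y ≤ (k : ℝ≥0)⁻¹ * ∑ i ∈ Finset.range k,
          (b * t ^ k * τ + L * τ * (E i).indicator (fun _ ↦ t ^ (i + 1)) y) := by
          refine mul_le_mul_right (Finset.sum_le_sum fun i hi ↦ hGle i hi y) _
      _ = _ := by
          rw [Finset.sum_add_distrib, Finset.sum_const, Finset.card_range, nsmul_eq_mul,
            ← Finset.mul_sum, mul_add, inv_mul_cancel_left₀ hk0, mul_assoc (k : ℝ≥0)⁻¹]
  have hhle : ∀ y, (h y : ℝ≥0∞) ≤
      ((b * t ^ k * τ : ℝ≥0) : ℝ≥0∞) + (((k : ℝ≥0)⁻¹ * (L * τ) : ℝ≥0) : ℝ≥0∞) * Z y := by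
    intro y
    refine (ENNReal.coe_le_coe.2 (hhle' y)).trans (le_of_eq ?_)
    rw [ENNReal.coe_add, ENNReal.coe_mul _ (∑ i ∈ Finset.range k, _), ENNReal.ofNNReal_finsetSum]
    congr 2
    refine Finset.sum_congr rfl fun i _ ↦ ?_
    by_cases hy : y ∈ E i
    · simp [hy]
    · simp [hy]
  have hhbdd : ∃ M : ℝ≥0, ∀ z, h z ≤ M := by
    refine ⟨b * t ^ k * τ + (k : ℝ≥0)⁻¹ * (L * τ) * ∑ i ∈ Finset.range k, t ^ (i + 1),
      fun y ↦ (hhle' y).trans ?_⟩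
    gcongr with i
    exact indicator_le_self _ _ _
  set η : ℝ≥0 := 2 * (2 * k * D ^ 3) ^ (1 / p) with hη
  have hηp : (η : ℝ≥0∞) ^ p = 2 ^ p * (2 * k * D ^ 3) := by
    have h1 : η ^ p = 2 ^ p * (2 * k * D ^ 3) := by
      rw [hη, NNReal.mul_rpow, ← NNReal.rpow_mul, one_div_mul_cancel hp0.ne', NNReal.rpow_one]
    rw [← ENNReal.coe_rpow_of_nonneg _ hp0.le, h1, ENNReal.coe_mul,
      ENNReal.coe_rpow_of_nonneg _ hp0.le]
    push_cast
    rfl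
  have hmean : maxMean ρ p (fun z ↦ (h z : ℝ≥0∞)) x (κH * infDist x Ωᶜ) ≤
      2 * (((b * t ^ k * τ : ℝ≥0) : ℝ≥0∞) + (((k : ℝ≥0)⁻¹ * (L * τ) : ℝ≥0) : ℝ≥0∞) * η) := by
    refine iSup₂_le fun r hr ↦ ballMean_add_mul_le hp1 (h0 x hx r hr.1) (hfin x r)
      ENNReal.coe_ne_top hhle ?_
    have hEB : ∀ i < k, ((t : ℝ≥0∞) ^ (i + 1)) ^ q * ρ (ball x r ∩ E i) ≤
        D ^ 3 * ρ (ball x r) := by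
      intro i _
      have h1 : (1 : ℝ≥0∞) ≤ t := by exact_mod_cast ht1
      have h2 : (D : ℝ≥0∞) ^ 2 ≤ ((t : ℝ≥0∞) ^ (i + 1)) ^ q := by
        calc (D : ℝ≥0∞) ^ 2 ≤ t := by exact_mod_cast htD
          _ ≤ (t : ℝ≥0∞) ^ (i + 1) := le_self_pow h1 i.succ_ne_zero
          _ = ((t : ℝ≥0∞) ^ (i + 1)) ^ (1 : ℝ) := (ENNReal.rpow_one _).symm
          _ ≤ ((t : ℝ≥0∞) ^ (i + 1)) ^ q :=
              ENNReal.rpow_le_rpow_of_exponent_le (one_le_pow₀ h1) hq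
      refine le_trans ?_ (measure_lt_maxMean_le hq0 h0 hfin (d := fun y ↦ infDist y Ωᶜ) hD hx hr.1
        (by nlinarith [hr.2]) (by simpa using hτpos.ne') ENNReal.coe_ne_top hτ h2)
      have hsub : ball x r ∩ E i ⊆ ball x r ∩ {y ∈ Ω | (t : ℝ≥0∞) ^ (i + 1) * τ <
          maxMean ρ q (fun z ↦ (g z : ℝ≥0∞)) y
            (min (κ * infDist y Ωᶜ) (κ * infDist x Ωᶜ / 4))} := by
        refine fun y hy ↦ ⟨hy.1, ?_⟩
        have := hEsub i ⟨ball_subset_ball hr.2.le hy.1, hy.2⟩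
        push_cast at this
        exact this
      exact mul_le_mul_right (measure_mono hsub) _
    refine (setLIntegral_sum_indicator_rpow_le ht hq0 hqp hEm hEB htk).trans (le_of_eq ?_)
    rw [hηp]
    ring
  have hfinal := (hH V hVlip h hVg hhbdd x hx).trans (mul_le_mul_right hmean _)
  rw [hVx, abs_of_nonneg (hu0 x)] at hfinal
  set dx : ℝ≥0 := (infDist x Ωᶜ).toNNReal with hdx'
  have hdxcoe : (dx : ℝ) = infDist x Ωᶜ := Real.coe_toNNReal _ hdx.le
  have hux : u x ≤
      (CH * dx * (2 * (b * t ^ k * τ + (k : ℝ≥0)⁻¹ * (L * τ) * η)) : ℝ≥0) := by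
    refine ENNReal.ofReal_le_coe.1 (hfinal.trans (le_of_eq ?_))
    push_cast
    rfl
  refine hux.trans ?_
  rw [← hdxcoe]
  have hηθ : (k : ℝ≥0)⁻¹ * η ≤ θ := by
    rw [inv_mul_le_iff₀ (pos_iff_ne_zero.2 hk0)]
    exact hθ
  have hle : CH * dx * (2 * (b * t ^ k * τ + (k : ℝ≥0)⁻¹ * (L * τ) * η)) ≤
      (2 * CH * (b * t ^ k + θ * b) + 8 * CH * θ * (3 * κP + 1) * S) * τ * dx := by
    calc CH * dx * (2 * (b * t ^ k * τ + (k : ℝ≥0)⁻¹ * (L * τ) * η))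
        = CH * dx * (2 * (b * t ^ k * τ + L * τ * ((k : ℝ≥0)⁻¹ * η))) := by ring
      _ ≤ CH * dx * (2 * (b * t ^ k * τ + L * τ * θ)) := by gcongr
      _ = _ := by rw [hL]; ring
  exact_mod_cast hle

end SelfImprovement

/-! ### Conclusion -/

section SelfImprovement

variable {X : Type*} [MetricSpace X] [MeasurableSpace X]

/-- A bootstrap with contraction factor at most `1 / 2` gives a bound independent of the constant
it starts from. -/
theorem HardyBound.of_improve {ρ : Measure X} {Ω : Set X} {q κ : ℝ} {u : X → ℝ} {g : X → ℝ≥0}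
    {A ε S₀ : ℝ≥0} (hε : 2 * ε ≤ 1) (h₀ : HardyBound ρ Ω q κ u g S₀)
    (himp : ∀ S, HardyBound ρ Ω q κ u g S → HardyBound ρ Ω q κ u g (A + ε * S)) :
    HardyBound ρ Ω q κ u g (2 * A) := by
  have hmono : ∀ S S' : ℝ≥0, S ≤ S' → HardyBound ρ Ω q κ u g S → HardyBound ρ Ω q κ u g S' := by
    intro S S' hSS' h y hy s hs
    refine (h y hy s hs).trans ?_
    have : (S : ℝ) ≤ S' := hSS'
    have := infDist_nonneg (x := y) (s := Ωᶜ)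
    gcongr
  have hn : ∀ n : ℕ, HardyBound ρ Ω q κ u g (2 * A + S₀ * (1 / 2) ^ n) := by
    intro n
    induction n with
    | zero => exact hmono _ _ (by simp) h₀
    | succ n ih =>
      refine hmono _ _ ?_ (himp _ ih)
      have hε' : ε ≤ 1 / 2 := by
        rw [le_div_iff₀ (by norm_num), mul_comm]
        exact hε
      calc A + ε * (2 * A + S₀ * (1 / 2) ^ n) ≤ A + 1 / 2 * (2 * A + S₀ * (1 / 2) ^ n) := by gcongr
        _ = 2 * A + S₀ * (1 / 2) ^ (n + 1) := by
          rw [mul_add, ← mul_assoc, pow_succ]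
          norm_num
          ring
  intro y hy s hs
  have hlim : Tendsto (fun n : ℕ ↦ ((2 * A + S₀ * (1 / 2) ^ n : ℝ≥0) : ℝ) * s * infDist y Ωᶜ) atTop
      (𝓝 (((2 * A : ℝ≥0) : ℝ) * s * infDist y Ωᶜ)) := by
    have h1 : Tendsto (fun n : ℕ ↦ (1 / 2 : ℝ) ^ n) atTop (𝓝 0) :=
      tendsto_pow_atTop_nhds_zero_of_lt_one (by norm_num) (by norm_num)
    have h2 := (((h1.const_mul (S₀ : ℝ)).const_add (2 * A : ℝ)).mul_const (s : ℝ)).mul_const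
      (infDist y Ωᶜ)
    simpa using h2
  exact ge_of_tendsto' hlim fun n ↦ hn n y hy s hs

/-- The constants of the bootstrap: the error factor `θ` is of order `k^{1/p - 1}`, hence small for
many levels `k`, and `q` is then so close to `p` that the powers `t^{i(p-q)}`, `i ≤ k`, stay
bounded. -/
theorem exists_levels_exponent {p₀ p : ℝ} (hp : 1 < p) (hp₀ : p₀ < p) (D : ℝ≥0) {t : ℝ≥0}
    (ht : 0 < t) {ε : ℝ≥0} (hε : 0 < ε) :
    ∃ k : ℕ, 0 < k ∧ 2 * (2 * k * D ^ 3) ^ (1 / p) ≤ k * ε ∧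
      ∃ q, p₀ < q ∧ q < p ∧ (t : ℝ≥0∞) ^ (k * (p - q)) ≤ 2 := by
  have hp0 : 0 < p := by linarith
  have hlim : Tendsto (fun k : ℕ ↦ 2 * (2 * (D : ℝ) ^ 3) ^ (1 / p) * (k : ℝ) ^ (-(1 - 1 / p)))
      atTop (𝓝 0) := by
    have h1 : 0 < 1 - 1 / p := by
      rw [sub_pos, div_lt_one hp0]
      exact hp
    have := ((tendsto_rpow_neg_atTop h1).comp tendsto_natCast_atTop_atTop).const_mul
      (2 * (2 * (D : ℝ) ^ 3) ^ (1 / p))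
    simpa using this
  obtain ⟨k, hkε, hk⟩ := ((hlim.eventually_lt_const (show (0 : ℝ) < ε from hε)).and
    (eventually_gt_atTop 0)).exists
  refine ⟨k, hk, ?_, ?_⟩
  · have hk' : (0 : ℝ) < k := by exact_mod_cast hk
    rw [← NNReal.coe_le_coe]
    push_cast
    have h1 : (2 * (k : ℝ) * (D : ℝ) ^ 3) ^ (1 / p) =
        (2 * (D : ℝ) ^ 3) ^ (1 / p) * ((k : ℝ) * (k : ℝ) ^ (-(1 - 1 / p))) := by
      rw [show 2 * (k : ℝ) * (D : ℝ) ^ 3 = 2 * (D : ℝ) ^ 3 * k by ring,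
        Real.mul_rpow (by positivity) hk'.le]
      congr 1
      nth_rewrite 2 [← Real.rpow_one (k : ℝ)]
      rw [← Real.rpow_add hk']
      congr 1
      ring
    rw [h1]
    calc 2 * ((2 * (D : ℝ) ^ 3) ^ (1 / p) * ((k : ℝ) * (k : ℝ) ^ (-(1 - 1 / p))))
        = k * (2 * (2 * (D : ℝ) ^ 3) ^ (1 / p) * (k : ℝ) ^ (-(1 - 1 / p))) := by ring
      _ ≤ k * (ε : ℝ) := mul_le_mul_of_nonneg_left hkε.le hk'.le
  · have hcont : ContinuousAt (fun q : ℝ ↦ (t : ℝ) ^ (k * (p - q))) p := by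
      refine ContinuousAt.rpow continuousAt_const (by fun_prop) (Or.inl ?_)
      exact_mod_cast ht.ne'
    have h2 : ∀ᶠ q in 𝓝[<] p, (t : ℝ) ^ (k * (p - q)) < 2 := by
      refine (hcont.eventually (gt_mem_nhds ?_)).filter_mono nhdsWithin_le_nhds
      simp
    obtain ⟨q, ⟨hq2, hq0⟩, hqp⟩ := ((h2.and (mem_nhdsWithin_of_mem_nhds (lt_mem_nhds hp₀) :
      ∀ᶠ q in 𝓝[<] p, p₀ < q)).and self_mem_nhdsWithin).exists
    refine ⟨q, hq0, hqp, ?_⟩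
    rw [← ENNReal.coe_rpow_of_ne_zero ht.ne']
    have : t ^ (k * (p - q)) ≤ 2 := by
      rw [← NNReal.coe_le_coe]
      push_cast
      exact hq2.le
    exact_mod_cast this

/-- A Lipschitz function vanishing outside `Ω` satisfies a Hardy inequality, with a bad constant,
as soon as `g` is bounded below by a positive number. -/
theorem HardyBound.of_lipZero {ρ : Measure X} {Ω : Set X} (hΩ : IsOpen Ω) (hΩc : Ωᶜ.Nonempty)
    (h0 : ∀ x ∈ Ω, ∀ r, 0 < r → 0 < ρ (ball x r))
    (hfin : ∀ x r, ρ (ball x r) < ∞) {q κ : ℝ} (hq : 0 < q) (hκ : 0 < κ) {u : X → ℝ}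
    (hu : u ∈ LipZero Ω) {g : X → ℝ≥0} {δ : ℝ≥0} (hδ : 0 < δ) (hg : ∀ y, δ ≤ g y) :
    ∃ S, HardyBound ρ Ω q κ u g S := by
  obtain ⟨⟨K, hK⟩, hu0⟩ := hu
  refine ⟨(K + 1) / δ, fun y hy s hs ↦ ?_⟩
  have hdy : 0 < infDist y Ωᶜ :=
    (hΩ.isClosed_compl.notMem_iff_infDist_pos hΩc).1 (not_not.2 hy)
  have hδs : δ ≤ s := by
    have h1 : (δ : ℝ≥0∞) ≤ s := le_trans (const_le_maxMean hq (h0 y hy) (hfin y)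
      (fun y ↦ ENNReal.coe_le_coe.2 (hg y)) (by positivity)) hs
    exact_mod_cast h1
  have hK0 : (0 : ℝ) < K + 1 := by positivity
  have h1 : u y / (K + 1) ≤ infDist y Ωᶜ := by
    rw [le_infDist hΩc]
    intro z hz
    rw [div_le_iff₀ hK0]
    have h2 := hK.dist_le_mul y z
    rw [hu0 z hz, Real.dist_eq, sub_zero] at h2
    have h3 := (le_abs_self _).trans h2
    have h4 : (0 : ℝ) ≤ dist y z := dist_nonneg
    nlinarith
  rw [div_le_iff₀ hK0] at h1
  have h2 : (1 : ℝ≥0) ≤ s / δ := by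
    rwa [le_div_iff₀ hδ, one_mul]
  have h3 : (1 : ℝ) ≤ s / δ := by exact_mod_cast h2
  push_cast
  calc u y ≤ infDist y Ωᶜ * (K + 1) * 1 := by rwa [mul_one]
    _ ≤ infDist y Ωᶜ * (K + 1) * (s / δ) := by gcongr
    _ = (K + 1) / δ * s * infDist y Ωᶜ := by ring

variable [BorelSpace X]

theorem wMeas_ball {μ : Measure X} {w : X → ℝ≥0∞} (x : X) (r : ℝ) :
    wMeas μ w (ball x r) = μ.withDensity w (ball x r) :=
  (withDensity_apply _ measurableSet_ball).symm

theorem wMean_eq_ballMean {μ : Measure X} {w : X → ℝ≥0∞} (hw : Measurable w) {f : X → ℝ≥0∞}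
    (hf : Measurable f) (p : ℝ) (x : X) (r : ℝ) :
    wMean μ w p f x r = ballMean (μ.withDensity w) p f x r := by
  rw [wMean, ballMean, wMeas_ball, setLIntegral_withDensity_eq_setLIntegral_mul μ hw
    (hf.pow_const p) measurableSet_ball]
  simp only [Pi.mul_apply, mul_comm (w _)]

theorem maximal_eq_maxMean {μ : Measure X} {w : X → ℝ≥0∞} (hw : Measurable w) {f : X → ℝ≥0∞}
    (hf : Measurable f) (Ω : Set X) (p κ : ℝ) (x : X) :
    maximal μ Ω w p κ f x = maxMean (μ.withDensity w) p f x (κ * infDist x Ωᶜ) := by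
  simp only [maximal, maxMean, wMean_eq_ballMean hw hf]

theorem maximalR_eq_maxMean {μ : Measure X} {w : X → ℝ≥0∞} (hw : Measurable w) {f : X → ℝ≥0∞}
    (hf : Measurable f) (Ω : Set X) (p κ R : ℝ) (x : X) :
    maximalR μ Ω w p κ R f x = maxMean (μ.withDensity w) p f x (min (κ * infDist x Ωᶜ) R) := by
  simp only [maximalR, maxMean, wMean_eq_ballMean hw hf]

/-- For a lower semicontinuous upper gradient `g` of `u`, the Poincaré condition bounds the
oscillation of `u` by maximal functions of `g` over small balls. -/
theorem abs_sub_le_of_isPoincareWeight {μ : Measure X} {Ω : Set X} {w : X → ℝ≥0∞}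
    (hw : Measurable w) (hΩ : IsOpen Ω) (hΩc : Ωᶜ.Nonempty)
    (h0 : ∀ x ∈ Ω, ∀ r, 0 < r → 0 < μ.withDensity w (ball x r))
    (hfin : ∀ x r, μ.withDensity w (ball x r) < ∞) {p₀ q : ℝ} (hp₀ : 0 < p₀) (hpq : p₀ ≤ q)
    {CA κP : ℝ≥0} {ν : ℝ} (hκP : 1 ≤ κP) {g : X → ℝ≥0}
    (hP : ∀ x ∈ Ω, ∀ y ∈ Ω, dist x y < infDist x Ωᶜ / (3 * κP) →
        ⨅ γ ∈ curvesBetween ν x y, γ.lineIntegral (fun z => (g z : ℝ≥0∞)) ≤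
          CA * ENNReal.ofReal (dist x y) *
            (maximalR μ Ω w p₀ κP (κP * dist x y) (fun z => (g z : ℝ≥0∞)) x +
              maximalR μ Ω w p₀ κP (κP * dist x y) (fun z => (g z : ℝ≥0∞)) y))
    {u : X → ℝ} (hg : IsUpperGradient g u) {y z : X} (hy : y ∈ Ω) (hz : z ∈ Ω)
    (hyz : dist y z < infDist y Ωᶜ / (3 * κP)) {s : ℝ≥0}
    (hsy : maxMean (μ.withDensity w) q (fun z ↦ (g z : ℝ≥0∞)) y (infDist y Ωᶜ / 2) ≤ s)
    (hsz : maxMean (μ.withDensity w) q (fun z ↦ (g z : ℝ≥0∞)) z (infDist y Ωᶜ / 2) ≤ s) :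
    |u y - u z| ≤ (2 * CA : ℝ≥0) * s * dist y z := by
  have hκP' : (1 : ℝ) ≤ κP := hκP
  have hdy : 0 < infDist y Ωᶜ :=
    (hΩ.isClosed_compl.notMem_iff_infDist_pos hΩc).1 (not_not.2 hy)
  have hgm : Measurable fun z ↦ (g z : ℝ≥0∞) := hg.1.coe_nnreal_ennreal
  have hR : κP * dist y z ≤ infDist y Ωᶜ / 2 := by
    rw [lt_div_iff₀ (by positivity)] at hyz
    nlinarith
  have hM : ∀ a ∈ Ω, maxMean (μ.withDensity w) q (fun z ↦ (g z : ℝ≥0∞)) a (infDist y Ωᶜ / 2) ≤ s →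
      maximalR μ Ω w p₀ κP (κP * dist y z) (fun z => (g z : ℝ≥0∞)) a ≤ s := by
    intro a ha h
    rw [maximalR_eq_maxMean hw hgm]
    exact (maxMean_mono_exponent hp₀ hpq hgm (h0 a ha) (hfin a)
      ((min_le_right _ _).trans hR)).trans h
  have hlow : ENNReal.ofReal |u y - u z| ≤
      ⨅ γ ∈ curvesBetween ν y z, γ.lineIntegral (fun z => (g z : ℝ≥0∞)) := by
    refine le_iInf₂ fun γ hγ ↦ ?_
    have := hg.2 γ
    rwa [hγ.1, hγ.2.1] at this
  have hmain : ENNReal.ofReal |u y - u z| ≤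
      CA * ENNReal.ofReal (dist y z) * ((s : ℝ≥0∞) + s) := by
    refine (hlow.trans (hP y hy z hz hyz)).trans ?_
    gcongr
    · exact hM y hy hsy
    · exact hM z hz hsz
  have hfinal : |u y - u z| ≤ (CA * nndist y z * (s + s) : ℝ≥0) := by
    refine ENNReal.ofReal_le_coe.1 (hmain.trans (le_of_eq ?_))
    rw [dist_nndist, ENNReal.ofReal_coe_nnreal]
    push_cast
    rfl
  refine hfinal.trans (le_of_eq ?_)
  push_cast
  ring

/-- The `p`-Hardy inequality improves to some `q < p`. A given upper gradient is first replaced by a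
lower semicontinuous one, bounded below by `δ > 0`, with almost the same maximal function at the
point `x` under consideration, and `δ` tends to `0` at the end. -/
theorem PointwiseHardyInequality.exists_lt {μ : Measure X} {CQC : ℝ} {Ω : Set X} (hΩ : IsOpen Ω)
    (hΩproper : Ω ≠ univ) {p₀ p : ℝ} (hp₀ : 1 ≤ p₀) (hp : p₀ < p) {w : X → ℝ≥0∞}
    (hw : IsSemilocallyDoubling μ Ω w) (hwP : IsPoincareWeight CQC μ Ω w p₀)
    (hH : PointwiseHardyInequality μ Ω w p) :
    ∃ q : ℝ, p₀ < q ∧ q < p ∧ PointwiseHardyInequality μ Ω w q := by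
  have hwm : Measurable w := hw.weight.measurable
  have hΩc : Ωᶜ.Nonempty := nonempty_compl.2 hΩproper
  set ρ := μ.withDensity w with hρ
  have hfin : ∀ x r, ρ (ball x r) < ∞ := by
    intro x r
    rcases le_or_gt r 0 with hr | hr
    · simp [ball_eq_empty.2 hr]
    · rw [← wMeas_ball]
      exact hw.weight.finite_ball x r hr
  have hdpos : ∀ y ∈ Ω, 0 < infDist y Ωᶜ := fun y hy ↦
    (hΩ.isClosed_compl.notMem_iff_infDist_pos hΩc).1 (not_not.2 hy)
  have h0 : ∀ x ∈ Ω, ∀ r, 0 < r → 0 < ρ (ball x r) := by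
    intro x hx r hr
    have hd := hdpos x hx
    obtain ⟨D, -, hD⟩ := hw.doubling (r / infDist x Ωᶜ) (by positivity)
    rw [← wMeas_ball]
    exact (hD x hx r hr (by rw [div_mul_cancel₀ _ hd.ne'])).1
  obtain ⟨CH, κH, hCH, hκH, hH⟩ := hH
  obtain ⟨-, CA, ν, κP, hCA, -, hκP, hP⟩ := hwP
  lift κP to ℝ≥0 using by linarith
  have hκP1 : 1 ≤ κP := by exact_mod_cast hκP.le
  -- For `y` in `B(x, κH d(x))` this gives `d(y) ≤ κ d(x) / 2`.
  set κ : ℝ := 2 * (1 + κH) with hκ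
  have hκ0 : 0 < κ := by linarith
  obtain ⟨D, -, hD⟩ := hw.doubling (4 * κ) (by positivity)
  have hDρ : ∀ y ∈ Ω, ∀ s, 0 < s → s ≤ 4 * κ * infDist y Ωᶜ →
      ρ (ball y s) ≤ D * ρ (ball y (s / 2)) := by
    intro y hy s hs hsκ
    rw [← wMeas_ball, ← wMeas_ball]
    exact (hD y hy s hs hsκ).2.1
  have hHρ : ∀ v ∈ LipZero Ω, ∀ h : X → ℝ≥0, IsUpperGradient h v →
      (∃ M : ℝ≥0, ∀ z, h z ≤ M) → ∀ x ∈ Ω, ENNReal.ofReal |v x| ≤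
        CH * ENNReal.ofReal (infDist x Ωᶜ) *
          maxMean ρ p (fun z ↦ (h z : ℝ≥0∞)) x (κH * infDist x Ωᶜ) := by
    intro v hv h hh hM x hx
    rw [← maximal_eq_maxMean hwm hh.1.coe_nnreal_ennreal]
    exact hH v hv h hh hM x hx
  set t : ℝ≥0 := max 2 (D ^ 2) with ht
  have ht2 : 2 ≤ t := le_max_left _ _
  have htD : D ^ 2 ≤ t := le_max_right _ _
  -- With this `θ` the contraction factor of the bootstrap is `8 CH θ (3 κP + 1) = 1 / 2`.
  set θ : ℝ≥0 := 1 / (16 * CH * (3 * κP + 1)) with hθ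
  obtain ⟨k, hk, hkθ, q, hp₀q, hqp, htk⟩ := exists_levels_exponent (hp₀.trans_lt hp) hp D
    (lt_of_lt_of_le (by norm_num) ht2) (show 0 < θ by positivity)
  have hq1 : 1 ≤ q := hp₀.trans hp₀q.le
  have hq0 : 0 < q := by linarith
  set A : ℝ≥0 := 2 * CH * (2 * CA * t ^ k + θ * (2 * CA)) with hA
  -- Adding one keeps the constant positive when `A = 0`.
  refine ⟨q, hp₀q, hqp, 2 * A + 1, κ, by positivity, by linarith, ?_⟩
  intro u hu g hg ⟨G, hG⟩ x hx
  have hκd : 0 < κ * infDist x Ωᶜ := mul_pos hκ0 (hdpos x hx)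
  have hgm : Measurable fun z ↦ (g z : ℝ≥0∞) := hg.1.coe_nnreal_ennreal
  rw [maximal_eq_maxMean hwm hgm, ← hρ]
  have hMfin : maxMean ρ q (fun z ↦ (g z : ℝ≥0∞)) x (κ * infDist x Ωᶜ) ≠ ∞ :=
    ((maxMean_le_const hq0 (h0 x hx) (hfin x) fun y ↦
      ENNReal.coe_le_coe.2 (hG y)).trans_lt ENNReal.coe_lt_top).ne
  lift maxMean ρ q (fun z ↦ (g z : ℝ≥0∞)) x (κ * infDist x Ωᶜ) to ℝ≥0 using hMfin with s hs
  have key : ∀ δ : ℝ≥0, 0 < δ → |u x| ≤ (2 * A : ℝ≥0) * (s + 2 * δ) * infDist x Ωᶜ := by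
    intro δ hδ
    obtain ⟨g', hlsc, hbdd, hδg, hgg', hint⟩ := exists_lowerSemicontinuous_majorant x (hfin x)
      (h0 x hx) hq0 hg.1 hG hκd hδ
    have hg' : IsUpperGradient g' (fun y ↦ |u y|) :=
      hg.abs.mono_off_point hlsc.measurable x hgg'
    have hu' : (fun y ↦ |u y|) ∈ LipZero Ω := lipZero_abs hu
    obtain ⟨S₀, hS₀⟩ := HardyBound.of_lipZero hΩ hΩc h0 hfin hq0 hκ0 hu' hδ hδg
    have hbound : HardyBound ρ Ω q κ (fun y ↦ |u y|) g' (2 * A) := by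
      refine HardyBound.of_improve (ε := 8 * CH * θ * (3 * κP + 1)) ?_ hS₀ fun S hS ↦
        HardyBound.improve hΩ hΩc h0 hfin hq1 hqp.le hκP1 (by linarith) le_rfl hHρ hDρ ht2 htD hk
          htk hkθ hu' (fun y ↦ abs_nonneg _) hδ hδg (fun y hy z hz hyz s' hsy hsz ↦ ?_) hS
      · rw [hθ]
        apply le_of_eq
        field_simp
        norm_num
      · exact abs_sub_le_of_isPoincareWeight hwm hΩ hΩc h0 hfin (by linarith) hp₀q.le hκP1
          (hP g' hlsc hbdd) hg' hy hz hyz hsy hsz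
    have := hbound x hx (s + 2 * δ) (iSup₂_le fun r hr ↦ ?_)
    · exact_mod_cast this
    · rw [ballMean_le_iff hq0 (h0 x hx r hr.1) (hfin x r)]
      have h1 := setLIntegral_le_of_maxMean_le hq0 (h0 x hx) (hfin x) hs.ge hr.1 hr.2
      have h2 : (2 : ℝ≥0∞) ≤ 2 ^ q := by
        calc (2 : ℝ≥0∞) = 2 ^ (1 : ℝ) := (ENNReal.rpow_one _).symm
          _ ≤ 2 ^ q := ENNReal.rpow_le_rpow_of_exponent_le (by norm_num) hq1
      calc _ ≤ _ := hint r hr.2.le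
        _ ≤ (s : ℝ≥0∞) ^ q * ρ (ball x r) + 2 ^ q * δ ^ q * ρ (ball x r) := by gcongr
        _ = ((s : ℝ≥0∞) ^ q + (2 * δ) ^ q) * ρ (ball x r) := by
            rw [ENNReal.mul_rpow_of_nonneg _ _ hq0.le]; ring
        _ ≤ ((s + 2 * δ : ℝ≥0) : ℝ≥0∞) ^ q * ρ (ball x r) := by
            push_cast
            gcongr
            exact ENNReal.add_rpow_le_rpow_add _ _ hq1
  have hlim : |u x| ≤ (2 * A : ℝ≥0) * s * infDist x Ωᶜ := by
    have hcont : Continuous fun δ : ℝ ↦ ((2 * A : ℝ≥0) : ℝ) * (s + 2 * δ) * infDist x Ωᶜ := by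
      fun_prop
    have htend : Tendsto
        (fun δ : ℝ ↦ ((2 * A : ℝ≥0) : ℝ) * (s + 2 * δ) * infDist x Ωᶜ)
        (𝓝[>] 0) (𝓝 (((2 * A : ℝ≥0) : ℝ) * s * infDist x Ωᶜ)) := by
      have := (hcont.tendsto 0).mono_left (nhdsWithin_le_nhds (s := Ioi (0 : ℝ)))
      simpa using this
    refine ge_of_tendsto htend ?_
    filter_upwards [self_mem_nhdsWithin] with δ hδ
    exact key ⟨δ, le_of_lt hδ⟩ hδ
  have hdx : (0 : ℝ) ≤ infDist x Ωᶜ := (hdpos x hx).le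
  calc ENNReal.ofReal |u x| ≤ ENNReal.ofReal ((2 * A : ℝ≥0) * s * infDist x Ωᶜ) :=
        ENNReal.ofReal_le_ofReal hlim
    _ = ((2 * A : ℝ≥0) : ℝ≥0∞) * ENNReal.ofReal (infDist x Ωᶜ) * s := by
        rw [ENNReal.ofReal_mul (by positivity), ENNReal.ofReal_mul (by positivity),
          ENNReal.ofReal_coe_nnreal, ENNReal.ofReal_coe_nnreal]
        ring
    _ ≤ ((2 * A + 1 : ℝ≥0) : ℝ≥0∞) * ENNReal.ofReal (infDist x Ωᶜ) * s := by
        gcongr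
        exact le_self_add

end SelfImprovement

end PointwiseHardy

end

theorem theorem7p3 {X : Type*} [MetricSpace X] [MeasurableSpace X] [BorelSpace X]
    (μ : MeasureTheory.Measure X) (hμ : PointwiseHardy.IsDoubling μ)
    (CQC : ℝ) (hCQC : 1 ≤ CQC) (hX : PointwiseHardy.IsQuasiconvex X CQC)
    (Ω : Set X) (hΩ : IsOpen Ω) (hΩne : Ω.Nonempty) (hΩproper : Ω ≠ Set.univ)
    (p₀ p : ℝ) (hp₀ : 1 ≤ p₀) (hp : p₀ < p)
    (w : X → ENNReal)
    (hw : PointwiseHardy.IsSemilocallyDoubling μ Ω w)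
    (hwP : PointwiseHardy.IsPoincareWeight CQC μ Ω w p₀)
    (hH : PointwiseHardy.PointwiseHardyInequality μ Ω w p) :
    ∃ q : ℝ, p₀ < q ∧ q < p ∧ PointwiseHardy.PointwiseHardyInequality μ Ω w q := by
  exact hH.exists_lt hΩ hΩproper hp₀ hp hw hwP
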